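/- All spaces are over the same scalar field, $\mathbb R$ or $\mathbb C$. A sequence $(E_n)_{n\ge1}$ of finite-dimensional subspaces of a Banach space $X$ is a *UFDD* (unconditional finite-dimensional Schauder decomposition) of $X$ if every $x\in X$ has a unique expansion $x=\sum_{n=1}^\infty x_n$ with $x_n\in E_n$ for all $n$, and this series always converges unconditionally. $X$ has (Gordon–Lewis) *local unconditional structure* if there is a constant $C$ such that for every finite-dimensional subspace $F$ of $X$ there are a finite-dimensional Banach lattice $Z$ and linear operators $A:F\to Z$, $B:Z\to X$ with $BAx=x$ for all $x\in F$ and $\|A\|\,\|B\|\le C$. (A complex Banach lattice is the complexification of a real Banach lattice, with $\|z\|=\|\,|z|\,\|$.) If $Y$ is a Banach space with an unconditional basis $(e_j)_{j\ge1}$, a sequence $(G_n)_{n\ge1}$ of subspaces of $Y$ is a *complemented block UFDD* with respect to $(e_j)$ if there are integers $0=p_0<p_1<p_2<\cdots$ and a bounded linear projection $P:Y\to Y$ such that, with $F_n=\operatorname{span}\{e_j: p_{n-1}<j\le p_n\}$, one has $G_n\subseteq F_n$ and $P(F_n)=G_n$ for every $n\ge1$. **Proposition 3.3.** Let $X$ be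 a Banach space with a UFDD $(E_n)$, and suppose that $X$ has local unconditional structure. Then there are a Banach space $Y$ with an unconditional basis $(e_j)_{j\ge1}$ and a linear isometric embedding $J:X\to Y$ such that $(J(E_n))_{n\ge1}$ is a complemented block UFDD with respect to $(e_j)$. -/

import Mathlib

open Filter Topology
open scoped TensorProduct

universe u v w

/-- A sequence `(Eₙ)` of subspaces of `X` is a Schauder decomposition of `X`: every `x : X` has
exactly one expansion `x = ∑ xₙ` (norm limit of the ordered partial sums) with `xₙ ∈ Eₙ`. -/
def IsSchauderDecomposition {𝕜 : Type v} [RCLike 𝕜] {X : Type u} [NormedAddCommGroup X]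
    [NormedSpace 𝕜 X] (E : ℕ → Submodule 𝕜 X) : Prop :=
  ∀ x : X, ∃! y : ℕ → X, (∀ n, y n ∈ E n) ∧
    Tendsto (fun N : ℕ => ∑ n ∈ Finset.range N, y n) atTop (𝓝 x)

/-- An unconditional finite-dimensional (Schauder) decomposition, UFDD: a Schauder decomposition
into finite-dimensional subspaces all of whose expansions converge unconditionally. -/
structure IsUFDD {𝕜 : Type v} [RCLike 𝕜] {X : Type u} [NormedAddCommGroup X]
    [NormedSpace 𝕜 X] (E : ℕ → Submodule 𝕜 X) : Prop where
  finiteDimensional : ∀ n, FiniteDimensional 𝕜 (E n)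
  decomposition : IsSchauderDecomposition E
  unconditional : ∀ (x : X) (y : ℕ → X), (∀ n, y n ∈ E n) →
    Tendsto (fun N : ℕ => ∑ n ∈ Finset.range N, y n) atTop (𝓝 x) → HasSum y x

/-- The real part `𝕜 ⊗ L → L`, `c ⊗ x ↦ (re c) x`, on the extension of scalars of a real vector
space `L`. For `𝕜 = ℂ` this is `x + iy ↦ x` on the complexification of `L`; for `𝕜 = ℝ` it is the
canonical identification of `ℝ ⊗ L` with `L`. -/
noncomputable def latticeRe (𝕜 : Type v) [RCLike 𝕜] (L : Type w) [AddCommGroup L] [Module ℝ L] :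
    𝕜 ⊗[ℝ] L →ₗ[ℝ] L :=
  (TensorProduct.lid ℝ L).toLinearMap ∘ₗ LinearMap.rTensor L (RCLike.reLm : 𝕜 →ₗ[ℝ] ℝ)

/-- `m` is the modulus of `z`, i.e. `m = |z| = sup {Re (u z) : u ∈ 𝕜, |u| = 1}` in the lattice `L`.
For `𝕜 = ℂ` this is the usual `|x + iy| = sup_θ (x cos θ + y sin θ)`; for `𝕜 = ℝ` it is
`|x| = x ⊔ (-x)`. -/
def IsLatticeModulus {𝕜 : Type v} [RCLike 𝕜] {L : Type w} [AddCommGroup L] [Lattice L]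
    [Module ℝ L] (z : 𝕜 ⊗[ℝ] L) (m : L) : Prop :=
  IsLUB {x : L | ∃ a : 𝕜, ‖a‖ = 1 ∧ x = latticeRe 𝕜 L (a • z)} m

/-- The normed space `Y` over `𝕜` (`ℝ` or `ℂ`) is a finite-dimensional Banach lattice: there is a
finite-dimensional real Banach lattice `L` (an ordered real vector space that is a lattice, with a
norm such that `|x| ≤ |y|` implies `‖x‖ ≤ ‖y‖`; completeness is automatic) such that `Y` is `L`
if `𝕜 = ℝ`, and the complexification of `L` if `𝕜 = ℂ`, normed by `‖z‖ = ‖ |z| ‖`.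
Taking `L : Type` is no restriction, since `L` is finite-dimensional over `ℝ`. -/
def IsFinDimBanachLattice (𝕜 : Type v) [RCLike 𝕜] (Y : Type w) [NormedAddCommGroup Y]
    [NormedSpace 𝕜 Y] : Prop :=
  ∃ (L : Type) (_ : NormedAddCommGroup L) (_ : Lattice L) (_ : IsOrderedAddMonoid L)
    (_ : HasSolidNorm L) (_ : NormedSpace ℝ L) (_ : IsOrderedModule ℝ L)
    (_ : FiniteDimensional ℝ L) (e : Y ≃ₗ[𝕜] 𝕜 ⊗[ℝ] L),
    ∀ y : Y, ∃ m : L, IsLatticeModulus (e y) m ∧ ‖y‖ = ‖m‖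

/-- Gordon-Lewis local unconditional structure (l.u.st.): for some constant `C`, the inclusion of
every finite-dimensional subspace `F` of `X` factors as `B ∘ A` through a finite-dimensional Banach
lattice `Z` with `‖A‖ ‖B‖ ≤ C`. (A finite-dimensional space over `𝕜 : Type v` has an isometric
copy in `Type v`, so that taking `Z : Type v` is no restriction.) -/
def HasLUST (𝕜 : Type v) [RCLike 𝕜] (X : Type u) [NormedAddCommGroup X] [NormedSpace 𝕜 X] :
    Prop :=
  ∃ C : ℝ, ∀ F : Submodule 𝕜 X, FiniteDimensional 𝕜 F →
    ∃ (Z : Type v) (_ : NormedAddCommGroup Z) (_ : NormedSpace 𝕜 Z)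
      (A : F →L[𝕜] Z) (B : Z →L[𝕜] X),
      IsFinDimBanachLattice 𝕜 Z ∧ ‖A‖ * ‖B‖ ≤ C ∧ ∀ x : F, B (A x) = (x : X)

/-- `(Eₙ)` is a complemented block UFDD with respect to the unconditional basis `(eⱼ)` of `Y`: there
are integers `0 = p₀ < p₁ < ⋯` and a bounded projection `P` on `Y` with `Eₙ ⊆ Fₙ` and `P(Fₙ) = Eₙ`,
where `Fₙ` is spanned by the `n`-th block of basis vectors. Blocks and basis vectors are numbered
from `0`, so that the block with index `n` consists of the `eⱼ` with `pₙ ≤ j < pₙ₊₁`. -/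
def IsComplementedBlockUFDD {𝕜 : Type v} [RCLike 𝕜] {Y : Type w} [NormedAddCommGroup Y]
    [NormedSpace 𝕜 Y] (e : UnconditionalSchauderBasis ℕ 𝕜 Y) (E : ℕ → Submodule 𝕜 Y) : Prop :=
  ∃ (p : ℕ → ℕ) (P : Y →L[𝕜] Y), StrictMono p ∧ p 0 = 0 ∧ IsIdempotentElem P ∧
    ∀ n, E n ≤ Submodule.span 𝕜 (e.basis '' Set.Ico (p n) (p (n + 1))) ∧
      (Submodule.span 𝕜 (e.basis '' Set.Ico (p n) (p (n + 1)))).map P.toLinearMap = E n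

/-! The summands of a UFDD have projections `Q n` whose finite sums are uniformly bounded by some
`K`. Factor the identity of the first `N` summands through a lattice as `B ∘ A`. In finite
dimensions such a lattice has coordinate vectors `e i` and a norm depending monotonically on the
absolute values of the coordinates. Cutting `A` and `B` by the projections gives functionals `a n i
= coord i ∘ A` on `E n` and vectors `b n i = Q n (B (e i))` with `∑ i, a n i x • b n i = x` on `E
n`. These rank one operators stay bounded under all multipliers of modulus at most one. Indeed,
Cauchy–Schwarz in `n` and Khintchine's inequality replace the two coordinate families by signed
sums, and the lattice norm controls the pairing of such sums over `i`.

The number of operators depends on `N`, which blocks a passage to the limit. Replacing each `a n i`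
by a multiple of a point in a finite net of the dual ball of `E n` fixes the index set. The merged
vectors then stay in a ball of the finite-dimensional space `E n`, so they converge along an
ultrafilter. The limit reproduces `E n` only up to an error `δ n`, which a block diagonal Neumann
series removes. Enumerating the blocks gives an exact unconditional frame `(a j, b j)` of `X`
(`IsUFDD.exists_isBlockFrame`).

Finally, take independent vectors `u j` lying over `b j`, with the norm of `∑ c j • u j` a supremum
over multipliers. Then `x ↦ ∑ a j x • u j` embeds `X`, and `u j ↦ b j` is a left inverse
(`IsBlockFrame.exists_embedding`). An equivalent norm makes the embedding isometric. Each block of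
`u j` is mapped into its own `E n` and reproduces it, so the induced projection respects the blocks.
-/

/-! ### Moments of signed sums. -/

section Khintchine

variable {𝕜 : Type*} [RCLike 𝕜] {ι : Type*} [DecidableEq ι]

/-- The signed sum `∑ n ∈ s, ± a n`, with sign `+` exactly on `t`. -/
def signSum {M : Type*} [AddCommGroup M] (s t : Finset ι) (a : ι → M) : M :=
  ∑ n ∈ s, if n ∈ t then a n else -a n

lemma signSum_insert_left {M : Type*} [AddCommGroup M] {s t : Finset ι} {n : ι} (hn : n ∉ s)
    (ht : t ⊆ s) (a : ι → M) : signSum (insert n s) t a = signSum s t a - a n := by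
  have : n ∉ t := fun h => hn (ht h)
  simp [signSum, Finset.sum_insert hn, this, sub_eq_neg_add]

lemma signSum_insert_insert {M : Type*} [AddCommGroup M] {s t : Finset ι} {n : ι} (hn : n ∉ s)
    (a : ι → M) : signSum (insert n s) (insert n t) a = signSum s t a + a n := by
  rw [signSum, Finset.sum_insert hn, if_pos (Finset.mem_insert_self _ _), add_comm]
  congr 1
  refine Finset.sum_congr rfl fun k hk => ?_
  have : k ≠ n := fun h => hn (h ▸ hk)
  simp [this]

lemma sum_norm_signSum_sq (s : Finset ι) (a : ι → 𝕜) :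
    ∑ t ∈ s.powerset, ‖signSum s t a‖ ^ 2 = 2 ^ s.card * ∑ n ∈ s, ‖a n‖ ^ 2 := by
  induction s using Finset.induction_on with
  | empty => simp [signSum]
  | insert n s hn ih =>
    rw [Finset.sum_powerset_insert hn, Finset.card_insert_of_notMem hn, Finset.sum_insert hn,
      ← Finset.sum_add_distrib]
    have : ∀ t ∈ s.powerset, ‖signSum (insert n s) t a‖ ^ 2 +
        ‖signSum (insert n s) (insert n t) a‖ ^ 2 = 2 * ‖signSum s t a‖ ^ 2 + 2 * ‖a n‖ ^ 2 := by
      intro t ht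
      rw [signSum_insert_left hn (Finset.mem_powerset.1 ht), signSum_insert_insert hn]
      have := parallelogram_law_with_norm 𝕜 (signSum s t a) (a n)
      nlinarith
    rw [Finset.sum_congr rfl this, Finset.sum_add_distrib, ← Finset.mul_sum, ih]
    simp [Finset.card_powerset]
    ring

lemma norm_sub_pow_four_add_norm_add_pow_four_le (x y : 𝕜) :
    ‖x - y‖ ^ 4 + ‖x + y‖ ^ 4 ≤ 2 * ‖x‖ ^ 4 + 12 * (‖x‖ ^ 2 * ‖y‖ ^ 2) + 2 * ‖y‖ ^ 4 := by
  have h1 := norm_add_sq (𝕜 := 𝕜) x y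
  have h2 := norm_sub_sq (𝕜 := 𝕜) x y
  have h3 : |RCLike.re (inner 𝕜 x y)| ≤ ‖x‖ * ‖y‖ :=
    (RCLike.abs_re_le_norm _).trans (norm_inner_le_norm x y)
  have h4 : (RCLike.re (inner 𝕜 x y)) ^ 2 ≤ (‖x‖ * ‖y‖) ^ 2 := sq_le_sq.2 (by
    rwa [abs_of_nonneg (by positivity : 0 ≤ ‖x‖ * ‖y‖)])
  have e1 : ‖x - y‖ ^ 4 = (‖x - y‖ ^ 2) ^ 2 := by ring
  have e2 : ‖x + y‖ ^ 4 = (‖x + y‖ ^ 2) ^ 2 := by ring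
  rw [e1, e2, h1, h2]
  nlinarith

lemma sum_norm_signSum_pow_four_le (s : Finset ι) (a : ι → 𝕜) :
    ∑ t ∈ s.powerset, ‖signSum s t a‖ ^ 4 ≤ 2 ^ s.card * (3 * (∑ n ∈ s, ‖a n‖ ^ 2) ^ 2) := by
  induction s using Finset.induction_on with
  | empty => simp [signSum]
  | insert n s hn ih =>
    rw [Finset.sum_powerset_insert hn, Finset.card_insert_of_notMem hn, Finset.sum_insert hn,
      ← Finset.sum_add_distrib]
    have : ∀ t ∈ s.powerset, ‖signSum (insert n s) t a‖ ^ 4 +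
        ‖signSum (insert n s) (insert n t) a‖ ^ 4 ≤
        2 * ‖signSum s t a‖ ^ 4 + (12 * ‖a n‖ ^ 2) * ‖signSum s t a‖ ^ 2 + 2 * ‖a n‖ ^ 4 := by
      intro t ht
      rw [signSum_insert_left hn (Finset.mem_powerset.1 ht), signSum_insert_insert hn]
      refine (norm_sub_pow_four_add_norm_add_pow_four_le _ _).trans (le_of_eq (by ring))
    refine (Finset.sum_le_sum this).trans ?_
    rw [Finset.sum_add_distrib, Finset.sum_add_distrib, ← Finset.mul_sum, ← Finset.mul_sum,
      sum_norm_signSum_sq, Finset.sum_const, Finset.card_powerset, nsmul_eq_mul]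
    push_cast
    have h0 : 0 ≤ (2 : ℝ) ^ s.card * ‖a n‖ ^ 4 := by positivity
    have : (2 : ℝ) ^ (s.card + 1) = 2 * 2 ^ s.card := by ring
    rw [this]
    nlinarith

/-- Khintchine's inequality between the first and second moments of a signed sum. -/
lemma sqrt_le_sum_norm_signSum (s : Finset ι) (a : ι → 𝕜) :
    2 ^ s.card * √(∑ n ∈ s, ‖a n‖ ^ 2) ≤ 2 * ∑ t ∈ s.powerset, ‖signSum s t a‖ := by
  set r := √(∑ n ∈ s, ‖a n‖ ^ 2) with hr
  have hr2 : r ^ 2 = ∑ n ∈ s, ‖a n‖ ^ 2 := Real.sq_sqrt (by positivity)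
  rcases eq_or_lt_of_le (Real.sqrt_nonneg (∑ n ∈ s, ‖a n‖ ^ 2)) with h0 | h0
  · rw [hr, ← h0]; simp; positivity
  rw [← hr] at h0
  -- The quartic touches the line at `t = 3r/2`. Summed over signs, the second moment `r²` and
  -- fourth moment at most `3r⁴` leave the factor `1 - 12/27 = 5/9 ≥ 1/2`.
  have key : ∀ t : ℝ, 0 ≤ t → r ^ 2 * t ^ 2 - 4 / 27 * t ^ 4 ≤ r ^ 3 * t := by
    intro t ht
    have : 0 ≤ (t - 3 / 2 * r) ^ 2 * (t + 3 * r) * t := by positivity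
    nlinarith
  have h1 := Finset.sum_le_sum fun t (_ : t ∈ s.powerset) => key _ (norm_nonneg (signSum s t a))
  rw [Finset.sum_sub_distrib, ← Finset.mul_sum, ← Finset.mul_sum, ← Finset.mul_sum,
    sum_norm_signSum_sq, ← hr2] at h1
  have h2 := sum_norm_signSum_pow_four_le s a
  rw [← hr2] at h2
  set m := ∑ t ∈ s.powerset, ‖signSum s t a‖
  have h3 : r ^ 3 * (2 ^ s.card * r * (5 / 9)) ≤ r ^ 3 * m := by nlinarith
  have h4 := le_of_mul_le_mul_left h3 (by positivity)
  have : 0 ≤ (2 : ℝ) ^ s.card * r := by positivity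
  linarith

lemma sum_norm_mul_norm_le (s : Finset ι) (a b : ι → 𝕜) :
    4 ^ s.card * ∑ n ∈ s, ‖a n‖ * ‖b n‖ ≤
      4 * ∑ t ∈ s.powerset, ∑ t' ∈ s.powerset, ‖signSum s t a‖ * ‖signSum s t' b‖ := by
  have h := Real.sum_mul_le_sqrt_mul_sqrt s (fun n => ‖a n‖) (fun n => ‖b n‖)
  have ha := sqrt_le_sum_norm_signSum s a
  have hb := sqrt_le_sum_norm_signSum s b
  have hab := mul_le_mul ha hb (by positivity) (by positivity)
  rw [← Finset.sum_mul_sum]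
  have e : (4 : ℝ) ^ s.card = 2 ^ s.card * 2 ^ s.card := by rw [← mul_pow]; norm_num
  calc _ ≤ 4 ^ s.card * (√(∑ n ∈ s, ‖a n‖ ^ 2) * √(∑ n ∈ s, ‖b n‖ ^ 2)) := by gcongr
    _ ≤ _ := by rw [e]; linarith

end Khintchine

/-! ### Coordinate projections of an unconditional decomposition. -/

section Projections

variable {𝕜 : Type v} [RCLike 𝕜] {X : Type u} [NormedAddCommGroup X] [NormedSpace 𝕜 X]

lemma exists_norm_sum_le_of_summable {ι : Type*} {y : ι → X} (hy : Summable y) :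
    ∃ M : ℝ, ∀ S : Finset ι, ‖∑ n ∈ S, y n‖ ≤ M := by
  classical
  obtain ⟨A, hA⟩ := (cauchySeq_finset_iff_vanishing_norm.1 hy.hasSum.cauchySeq) 1 one_pos
  refine ⟨∑ n ∈ A, ‖y n‖ + 1, fun S => ?_⟩
  rw [← Finset.sum_inter_add_sum_sdiff S A]
  refine (norm_add_le _ _).trans (add_le_add ?_ (hA _ Finset.sdiff_disjoint).le)
  exact (norm_sum_le _ _).trans (Finset.sum_le_sum_of_subset_of_nonneg Finset.inter_subset_right
    fun _ _ _ => norm_nonneg _)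

/-- The pairs `(x, f)` where `x = ∑ yₙ` unconditionally with `yₙ ∈ Eₙ`, and `f` is the bounded
family of all finite partial sums of this series. -/
def expansionSubmodule (E : ℕ → Submodule 𝕜 X) :
    Submodule 𝕜 (X × lp (fun _ : Finset ℕ => X) ⊤) where
  carrier := {q | (∀ n, q.2 {n} ∈ E n) ∧ (∀ S, q.2 S = ∑ n ∈ S, q.2 {n}) ∧
    Tendsto (q.2 : Finset ℕ → X) atTop (𝓝 q.1)}
  zero_mem' := ⟨by simp, by simp, by simpa using! tendsto_const_nhds⟩
  add_mem' := by
    rintro a b ⟨ha1, ha2, ha3⟩ ⟨hb1, hb2, hb3⟩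
    refine ⟨fun n => by simpa using (E n).add_mem (ha1 n) (hb1 n), fun S => ?_, ?_⟩
    · simp only [Prod.snd_add, lp.coeFn_add, Pi.add_apply, Finset.sum_add_distrib]
      rw [ha2, hb2]
    · simpa using! ha3.add hb3
  smul_mem' := by
    rintro c a ⟨ha1, ha2, ha3⟩
    refine ⟨fun n => by simpa using (E n).smul_mem c (ha1 n), fun S => ?_, ?_⟩
    · simp only [Prod.smul_snd, lp.coeFn_smul, Pi.smul_apply, ← Finset.smul_sum]
      rw [ha2]
    · simpa using! ha3.const_smul c

lemma isClosed_expansionSubmodule (E : ℕ → Submodule 𝕜 X)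
    (hE : ∀ n, IsClosed (E n : Set X)) :
    IsClosed (expansionSubmodule E : Set (X × lp (fun _ : Finset ℕ => X) ⊤)) := by
  have hev : ∀ S : Finset ℕ,
      Continuous fun q : X × lp (fun _ : Finset ℕ => X) ⊤ => q.2 S := fun S =>
    (lp.evalCLM 𝕜 (fun _ : Finset ℕ => X) ⊤ S).continuous.comp continuous_snd
  have h1 : IsClosed {q : X × lp (fun _ : Finset ℕ => X) ⊤ | ∀ n, q.2 {n} ∈ E n} := by
    simp only [Set.ofPred_forall]
    exact isClosed_iInter fun n => (hE n).preimage (hev _)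
  have h2 : IsClosed {q : X × lp (fun _ : Finset ℕ => X) ⊤ |
      ∀ S, q.2 S = ∑ n ∈ S, q.2 {n}} := by
    simp only [Set.ofPred_forall]
    exact isClosed_iInter fun S =>
      isClosed_eq (hev _) (continuous_finsetSum _ fun n _ => hev _)
  have h3 : IsClosed {q : X × lp (fun _ : Finset ℕ => X) ⊤ |
      Tendsto (q.2 : Finset ℕ → X) atTop (𝓝 q.1)} := by
    refine isClosed_of_closure_subset fun q hq => ?_
    refine Metric.tendsto_atTop.2 fun ε hε => ?_
    obtain ⟨r, hr, hqr⟩ := Metric.mem_closure_iff.1 hq (ε / 3) (by positivity)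
    obtain ⟨S₀, hS₀⟩ := Metric.tendsto_atTop.1 hr (ε / 3) (by positivity)
    refine ⟨S₀, fun S hS => ?_⟩
    have a1 : dist q.1 r.1 < ε / 3 := lt_of_le_of_lt (le_max_left _ _) hqr
    have a2 : dist q.2 r.2 < ε / 3 := lt_of_le_of_lt (le_max_right _ _) hqr
    have a3 : dist (q.2 S) (r.2 S) ≤ dist q.2 r.2 := by
      rw [dist_eq_norm, dist_eq_norm]
      exact lp.norm_apply_le_norm (by simp) (q.2 - r.2) S
    have a4 := hS₀ S hS
    calc dist (q.2 S) q.1 ≤ dist (q.2 S) (r.2 S) + dist (r.2 S) r.1 + dist r.1 q.1 :=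
          dist_triangle4 _ _ _ _
      _ < ε := by rw [dist_comm r.1]; linarith
  exact h1.inter (h2.inter h3)

/-- `Q` is the sequence of coordinate projections of an unconditional decomposition `E`, and `K`
bounds the projections onto finitely many summands. -/
structure IsProjectionSystem (E : ℕ → Submodule 𝕜 X) (Q : ∀ n, X →L[𝕜] E n) (K : ℝ) : Prop where
  hasSum : ∀ x, HasSum (fun n => (Q n x : X)) x
  apply_self : ∀ n (x : E n), Q n x = x
  apply_of_ne : ∀ n m, m ≠ n → ∀ x ∈ E m, Q n x = 0
  norm_sum_proj_le : ∀ (S : Finset ℕ) x, ‖∑ n ∈ S, (Q n x : X)‖ ≤ K * ‖x‖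
  nonneg : 0 ≤ K

/-- A UFDD of a Banach space has continuous coordinate projections, and the projections onto
finitely many summands are uniformly bounded. -/
theorem IsUFDD.exists_isProjectionSystem [CompleteSpace X] {E : ℕ → Submodule 𝕜 X}
    (hE : IsUFDD E) : ∃ (Q : ∀ n, X →L[𝕜] E n) (K : ℝ), IsProjectionSystem E Q K := by
  have hcl : ∀ n, IsClosed (E n : Set X) := fun n => by
    have := hE.finiteDimensional n
    exact Submodule.closed_of_finiteDimensional _
  set W := expansionSubmodule E with hW
  have : CompleteSpace W := (isClosed_expansionSubmodule E hcl).completeSpace_coe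
  let π : W →L[𝕜] X := (ContinuousLinearMap.fst 𝕜 X _).comp W.subtypeL
  have hsum : ∀ q : W, HasSum (fun n => (q : X × lp (fun _ : Finset ℕ => X) ⊤).2 {n}) (π q) := by
    rintro ⟨q, h1, h2, h3⟩
    exact h3.congr h2
  have huniq : ∀ (y z : ℕ → X) (x : X), (∀ n, y n ∈ E n) → (∀ n, z n ∈ E n) → HasSum y x →
      HasSum z x → y = z := fun y z x hy hz hyx hzx =>
    (hE.decomposition x).unique ⟨hy, hyx.tendsto_sum_nat⟩ ⟨hz, hzx.tendsto_sum_nat⟩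
  have hinj : Function.Injective π := by
    intro q r hqr
    have h := huniq _ _ _ q.2.1 r.2.1 (hsum q) (hqr ▸ hsum r)
    refine Subtype.ext (Prod.ext hqr (lp.ext (funext fun S => ?_)))
    rw [q.2.2.1 S, r.2.2.1 S]
    exact Finset.sum_congr rfl fun n _ => congrFun h n
  have hsurj : Function.Surjective π := by
    intro x
    obtain ⟨y, ⟨hy1, hy2⟩, -⟩ := hE.decomposition x
    have hyx := hE.unconditional x y hy1 hy2
    obtain ⟨M, hM⟩ := exists_norm_sum_le_of_summable hyx.summable
    let f : lp (fun _ : Finset ℕ => X) ⊤ := ⟨fun S => ∑ n ∈ S, y n,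
      memℓp_infty ⟨M, by rintro _ ⟨S, rfl⟩; exact hM S⟩⟩
    have hf : ∀ S, f S = ∑ n ∈ S, y n := fun S => rfl
    exact ⟨⟨(x, f), fun n => by simpa [hf] using hy1 n, fun S => by simp [hf], hyx⟩, rfl⟩
  -- Open mapping theorem: the norm of the inverse bounds all finite partial sums of an expansion at
  -- once.
  let e : W ≃L[𝕜] X := ContinuousLinearEquiv.ofBijective π (LinearMap.ker_eq_bot.2 hinj)
    (LinearMap.range_eq_top.2 hsurj)
  have he : ∀ x, π (e.symm x) = x := fun x => e.apply_symm_apply x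
  let g : ∀ S : Finset ℕ, X →L[𝕜] X := fun S =>
    (lp.evalCLM 𝕜 (fun _ : Finset ℕ => X) ⊤ S).comp
      ((ContinuousLinearMap.snd 𝕜 X _).comp (W.subtypeL.comp (e.symm : X →L[𝕜] W)))
  let Q : ∀ n, X →L[𝕜] E n := fun n => (g {n}).codRestrict (E n) fun x => (e.symm x).2.1 n
  have hQ : ∀ n x, (Q n x : X) = (e.symm x : X × lp (fun _ : Finset ℕ => X) ⊤).2 {n} :=
    fun _ _ => rfl
  have hQs : ∀ x, HasSum (fun n => (Q n x : X)) x := fun x => by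
    have := hsum (e.symm x)
    rwa [he] at this
  have hsingle : ∀ m (x : X), x ∈ E m → (fun n => (Q n x : X)) = Pi.single m x := by
    intro m x hx
    refine huniq _ _ x (fun n => (Q n x).2) (fun n => ?_) (hQs x) (hasSum_pi_single m x)
    rcases eq_or_ne n m with rfl | h
    · simpa using hx
    · simp [Pi.single_eq_of_ne h]
  refine ⟨Q, ‖(e.symm : X →L[𝕜] W)‖, hQs, fun n x => ?_, fun n m hmn x hx => ?_, fun S x => ?_,
    (e.symm : X →L[𝕜] W).opNorm_nonneg⟩
  · have := congrFun (hsingle n x x.2) n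
    rw [Pi.single_eq_same] at this
    exact Subtype.ext this
  · have := congrFun (hsingle m x hx) n
    rw [Pi.single_eq_of_ne hmn.symm] at this
    exact Subtype.ext this
  · have h2 := (e.symm x).2.2.1 S
    simp only [hQ]
    rw [← h2]
    calc _ ≤ ‖(e.symm x : X × lp (fun _ : Finset ℕ => X) ⊤).2‖ :=
          lp.norm_apply_le_norm (by simp) _ _
      _ ≤ ‖(e.symm x : X × lp (fun _ : Finset ℕ => X) ⊤)‖ := le_max_right _ _
      _ ≤ _ := (e.symm : X →L[𝕜] W).le_opNorm x

end Projections

/-! ### Atoms of a finite-dimensional Banach lattice. -/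

section FiniteDimensionalLattice

variable {L : Type*} [NormedAddCommGroup L] [Lattice L]

lemma inf_eq_zero_of_le {a b c : L} (hab : a ⊓ b = 0) (hc : 0 ≤ c) (hcb : c ≤ b) :
    a ⊓ c = 0 :=
  le_antisymm (hab ▸ inf_le_inf_left a hcb) (le_inf (hab ▸ inf_le_left) hc)

/-- A finite set of pairwise disjoint strictly positive elements. -/
def IsDisjointSystem (D : Finset L) : Prop :=
  (∀ x ∈ D, 0 < x) ∧ ∀ x ∈ D, ∀ y ∈ D, x ≠ y → x ⊓ y = 0

lemma IsDisjointSystem.mono {D D' : Finset L} (hD : IsDisjointSystem D) (h : D' ⊆ D) :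
    IsDisjointSystem D' :=
  ⟨fun x hx => hD.1 x (h hx), fun x hx y hy => hD.2 x (h hx) y (h hy)⟩

lemma IsDisjointSystem.insert [DecidableEq L] {D : Finset L} (hD : IsDisjointSystem D) {x : L}
    (hx : 0 < x) (h : ∀ y ∈ D, y ⊓ x = 0) :
    IsDisjointSystem (insert x D) ∧ (insert x D).card = D.card + 1 := by
  refine ⟨⟨fun y hy => ?_, fun y hy z hz hyz => ?_⟩, Finset.card_insert_of_notMem fun hxD => ?_⟩
  · rcases Finset.mem_insert.1 hy with rfl | hy
    exacts [hx, hD.1 y hy]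
  · rcases Finset.mem_insert.1 hy with rfl | hyD <;> rcases Finset.mem_insert.1 hz with rfl | hzD
    · exact absurd rfl hyz
    · rw [inf_comm]; exact h z hzD
    · exact h y hyD
    · exact hD.2 y hyD z hzD hyz
  · have := h x hxD
    rw [inf_idem] at this
    exact hx.ne' this

variable [IsOrderedAddMonoid L]

/-- For `z = a ⊓ (b + c)`, the remainder `z - z ⊓ b` lies below both `a` and `c`, hence below `0`;
so `z ≤ b`, and `z` is below `a ⊓ b`. -/
lemma inf_add_eq_zero {a b c : L} (hb : 0 ≤ b) (hab : a ⊓ b = 0)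
    (hac : a ⊓ c = 0) : a ⊓ (b + c) = 0 := by
  have ha : 0 ≤ a := hab ▸ inf_le_left
  have hc : 0 ≤ c := hac ▸ inf_le_right
  set z := a ⊓ (b + c) with hz
  have hz0 : 0 ≤ z := le_inf ha (add_nonneg hb hc)
  have h1 : z - z ⊓ b ≤ c := by
    rw [sub_le_iff_le_add, ← sub_le_iff_le_add']
    refine le_inf (sub_le_self _ hc) ?_
    rw [sub_le_iff_le_add]
    exact inf_le_right
  have h2 : z - z ⊓ b ≤ a := (sub_le_self _ (le_inf hz0 hb)).trans inf_le_left
  have h3 : z ≤ b := by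
    have : z - z ⊓ b ≤ 0 := hac ▸ le_inf h2 h1
    exact (sub_nonpos.1 this).trans inf_le_right
  exact le_antisymm (hab ▸ le_inf inf_le_left h3) hz0

lemma inf_sum_eq_zero {ι : Type*} {a : L} (ha : 0 ≤ a) (s : Finset ι) (f : ι → L)
    (h : ∀ i ∈ s, a ⊓ f i = 0) : a ⊓ ∑ i ∈ s, f i = 0 := by
  classical
  induction s using Finset.induction_on with
  | empty => simpa using ha
  | insert i s hi ih =>
    rw [Finset.sum_insert hi]
    have h1 := h i (Finset.mem_insert_self _ _)
    exact inf_add_eq_zero (h1 ▸ inf_le_right) h1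
      (ih fun j hj => h j (Finset.mem_insert_of_mem hj))

variable [NormedSpace ℝ L]

lemma isClosed_setOf_smul_le [HasSolidNorm L] (e x : L) : IsClosed {t : ℝ | t • e ≤ x} :=
  isClosed_le (continuous_id.smul continuous_const) continuous_const

variable [IsOrderedModule ℝ L]

lemma inf_smul_eq_zero {a b : L} (hab : a ⊓ b = 0) {t : ℝ} (ht : 0 ≤ t) : a ⊓ t • b = 0 := by
  have ha : 0 ≤ a := hab ▸ inf_le_left
  have hb : 0 ≤ b := hab ▸ inf_le_right
  obtain ⟨n, hn⟩ := exists_nat_ge t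
  have h1 : a ⊓ (n : ℝ) • b = 0 := by
    rw [Nat.cast_smul_eq_nsmul]
    simpa using inf_sum_eq_zero ha (Finset.range n) (fun _ => b) fun _ _ => hab
  exact inf_eq_zero_of_le h1 (smul_nonneg ht hb) (smul_le_smul_of_nonneg_right hn hb)

lemma abs_smul_of_nonneg (c : ℝ) {x : L} (hx : 0 ≤ x) : |c • x| = |c| • x := by
  rcases le_total 0 c with h | h
  · rw [abs_of_nonneg h, abs_of_nonneg (smul_nonneg h hx)]
  · rw [abs_of_nonpos h, abs_of_nonpos (smul_nonpos_of_nonpos_of_nonneg h hx), neg_smul]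

/-- In a linear relation, the modulus of one term is dominated by the sum of the moduli of the
others, yet is disjoint from that sum, so it vanishes. -/
lemma IsDisjointSystem.linearIndepOn {D : Finset L} (hD : IsDisjointSystem D) :
    LinearIndependent ℝ ((↑) : D → L) := by
  classical
  refine linearIndependent_iff'.2 fun s g hg i hi => ?_
  rw [← Finset.add_sum_erase _ _ hi, add_eq_zero_iff_eq_neg] at hg
  have hpos : ∀ j : D, 0 ≤ (j : L) := fun j => (hD.1 j j.2).le
  have h1 : |g i| • (i : L) ≤ ∑ j ∈ s.erase i, |g j| • (j : L) := by
    rw [← abs_smul_of_nonneg _ (hpos i), hg, abs_neg]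
    refine (Finset.le_sum_of_subadditive (fun x : L => |x|) (by simp) abs_add_le _ _).trans (le_of_eq ?_)
    exact Finset.sum_congr rfl fun j _ => abs_smul_of_nonneg (g j) (hpos j)
  have h2 : (|g i| • (i : L)) ⊓ ∑ j ∈ s.erase i, |g j| • (j : L) = 0 := by
    refine inf_sum_eq_zero (smul_nonneg (abs_nonneg _) (hpos i)) _ _ fun j hj => ?_
    refine inf_smul_eq_zero ?_ (abs_nonneg _)
    rw [inf_comm]
    refine inf_smul_eq_zero (hD.2 j j.2 i i.2 fun h => ?_) (abs_nonneg _)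
    exact (Finset.ne_of_mem_erase hj) (Subtype.ext h)
  rw [inf_eq_left.2 h1, smul_eq_zero, abs_eq_zero] at h2
  exact h2.resolve_right (hD.1 i i.2).ne'

lemma exists_maximal_isDisjointSystem [FiniteDimensional ℝ L] : ∃ D : Finset L,
    IsDisjointSystem D ∧ ∀ D' : Finset L, IsDisjointSystem D' → D'.card ≤ D.card := by
  classical
  have hbdd : BddAbove {n | ∃ D : Finset L, IsDisjointSystem D ∧ D.card = n} := by
    refine ⟨Module.finrank ℝ L, ?_⟩
    rintro _ ⟨D, hD, rfl⟩
    simpa using hD.linearIndepOn.fintype_card_le_finrank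
  have hne : {n | ∃ D : Finset L, IsDisjointSystem D ∧ D.card = n}.Nonempty :=
    ⟨0, ∅, ⟨by simp, by simp⟩, rfl⟩
  obtain ⟨D, hD, hc⟩ := Nat.sSup_mem hne hbdd
  exact ⟨D, hD, fun D' hD' => hc ▸ le_csSup hbdd ⟨D', hD', rfl⟩⟩

variable [HasSolidNorm L]

lemma bddAbove_setOf_smul_le {e : L} (he : 0 < e) (x : L) : BddAbove {t : ℝ | t • e ≤ x} := by
  refine ⟨‖x‖ / ‖e‖, fun t (ht : t • e ≤ x) => ?_⟩
  rcases le_or_gt t 0 with h | h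
  · exact h.trans (by positivity)
  have h1 : ‖t • e‖ ≤ ‖x‖ := norm_le_norm_of_abs_le_abs (by
    rw [abs_of_nonneg (smul_nonneg h.le he.le)]
    exact ht.trans (le_abs_self x))
  rw [norm_smul, Real.norm_of_nonneg h.le] at h1
  rwa [le_div_iff₀ (norm_pos_iff.2 he.ne')]

/-- Members of a largest disjoint system are atoms. If `x` were incomparable with `t • e`, the
positive and negative parts of `x - t • e` could replace `e` and enlarge the system. Comparability
with every multiple forces equality at the largest multiple below `x`. -/
lemma eq_smul_of_le_of_maximal {D : Finset L} (hD : IsDisjointSystem D)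
    (hmax : ∀ D' : Finset L, IsDisjointSystem D' → D'.card ≤ D.card) {e : L} (he : e ∈ D)
    {x : L} (hx : 0 ≤ x) (hxe : x ≤ e) : ∃ t : ℝ, 0 ≤ t ∧ x = t • e := by
  classical
  have he0 := hD.1 e he
  have htot : ∀ t : ℝ, 0 ≤ t → x ≤ t • e ∨ t • e ≤ x := by
    intro t ht
    by_contra! hcon
    set p := (x - t • e)⁺ with hp
    set q := (x - t • e)⁻ with hq
    have hp0 : 0 < p := lt_of_le_of_ne (posPart_nonneg _) fun h =>
      hcon.1 (sub_nonpos.1 (posPart_eq_zero.1 h.symm))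
    have hq0 : 0 < q := lt_of_le_of_ne (negPart_nonneg _) fun h =>
      hcon.2 (sub_nonneg.1 (negPart_eq_zero.1 h.symm))
    have hpq : p ⊓ q = 0 := posPart_inf_negPart_eq_zero _
    have hte : 0 ≤ t • e := smul_nonneg ht he0.le
    have hpe : p ≤ e := (sup_le (sub_le_self _ hte) hx).trans hxe
    have hqe : q ≤ t • e := sup_le (by rw [neg_sub]; exact sub_le_self _ hx) hte
    have hpd : ∀ f ∈ D.erase e, f ⊓ p = 0 := fun f hf =>
      inf_eq_zero_of_le (hD.2 f (Finset.mem_of_mem_erase hf) e he (Finset.ne_of_mem_erase hf))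
        hp0.le hpe
    have hqd : ∀ f ∈ D.erase e, f ⊓ q = 0 := fun f hf =>
      inf_eq_zero_of_le (inf_smul_eq_zero
        (hD.2 f (Finset.mem_of_mem_erase hf) e he (Finset.ne_of_mem_erase hf)) ht) hq0.le hqe
    have h1 := (hD.mono (Finset.erase_subset e D)).insert hq0 hqd
    have h2 := h1.1.insert (x := p) hp0 (by
      intro f hf
      rcases Finset.mem_insert.1 hf with rfl | hf
      · rwa [inf_comm]
      · exact hpd f hf)
    have h3 := hmax _ h2.1
    rw [h2.2, h1.2, Finset.card_erase_of_mem he] at h3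
    have := Finset.card_pos.2 ⟨e, he⟩
    omega
  set S := {t : ℝ | t • e ≤ x}
  have h0 : (0 : ℝ) ∈ S := by simpa [S] using hx
  have hb := bddAbove_setOf_smul_le he0 x
  have hmem : sSup S ∈ S := (isClosed_setOf_smul_le e x).csSup_mem ⟨0, h0⟩ hb
  have hs0 : 0 ≤ sSup S := le_csSup hb h0
  refine ⟨sSup S, hs0, le_antisymm ?_ hmem⟩
  have hcl : IsClosed {t : ℝ | x ≤ t • e} :=
    isClosed_le continuous_const (continuous_id.smul continuous_const)
  have hsub : Set.Ioi (sSup S) ⊆ {t : ℝ | x ≤ t • e} := fun t (ht : sSup S < t) =>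
    (htot t (hs0.trans ht.le)).resolve_right fun h => (le_csSup hb h).not_gt ht
  have := hcl.closure_subset_iff.2 hsub
  rw [closure_Ioi] at this
  exact this (Set.mem_Ici.2 le_rfl)

/-- Subtract from `x` the largest multiple of each atom below it. The remainder is disjoint from
every atom, since otherwise a coefficient could grow; if nonzero, it would enlarge the system. -/
lemma mem_span_of_maximal {D : Finset L} (hD : IsDisjointSystem D)
    (hmax : ∀ D' : Finset L, IsDisjointSystem D' → D'.card ≤ D.card) {x : L} (hx : 0 ≤ x) :
    ∃ c : L → ℝ, (∀ e, 0 ≤ c e) ∧ x = ∑ e ∈ D, c e • e := by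
  classical
  set c : L → ℝ := fun e => sSup {t : ℝ | t • e ≤ x} with hc
  have h0 : ∀ e, (0 : ℝ) ∈ {t : ℝ | t • e ≤ x} := fun e => by simpa using hx
  have hb : ∀ e ∈ D, BddAbove {t : ℝ | t • e ≤ x} := fun e he =>
    bddAbove_setOf_smul_le (hD.1 e he) x
  have hc0 : ∀ e ∈ D, 0 ≤ c e := fun e he => le_csSup (hb e he) (h0 e)
  have hmem : ∀ e ∈ D, c e • e ≤ x := fun e he =>
    (isClosed_setOf_smul_le e x).csSup_mem ⟨0, h0 e⟩ (hb e he)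
  have hdis : ∀ e ∈ D, ∀ f ∈ D, e ≠ f → (c e • e) ⊓ (c f • f) = 0 := fun e he f hf hef => by
    refine inf_smul_eq_zero ?_ (hc0 f hf)
    rw [inf_comm]
    exact inf_smul_eq_zero (hD.2 f hf e he hef.symm) (hc0 e he)
  -- The sum of disjoint positive elements is their supremum.
  have hle : ∀ S ⊆ D, ∑ e ∈ S, c e • e ≤ x := by
    intro S
    induction S using Finset.induction_on with
    | empty => intro _; simpa using hx
    | insert e S he ih =>
      intro hS
      have heD := hS (Finset.mem_insert_self _ _)
      have hSD := (Finset.subset_insert e S).trans hS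
      have h1 : (c e • e) ⊓ ∑ f ∈ S, c f • f = 0 :=
        inf_sum_eq_zero (smul_nonneg (hc0 e heD) (hD.1 e heD).le) _ _ fun f hf =>
          hdis e heD f (hSD hf) fun h => he (h ▸ hf)
      rw [Finset.sum_insert he, ← inf_add_sup, h1, zero_add]
      exact sup_le (hmem e heD) (ih hSD)
  have hy0 : 0 ≤ x - ∑ e ∈ D, c e • e := sub_nonneg.2 (hle D subset_rfl)
  have hyd : ∀ e ∈ D, e ⊓ (x - ∑ e ∈ D, c e • e) = 0 := by
    intro e he
    obtain ⟨s, hs0, hs⟩ := eq_smul_of_le_of_maximal hD hmax he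
      (le_inf (hD.1 e he).le hy0) inf_le_left
    have h1 : s • e ≤ x - ∑ e ∈ D, c e • e := hs ▸ inf_le_right
    have h2 : (c e + s) • e ≤ x := by
      rw [← Finset.add_sum_erase D _ he] at h1
      have h3 : 0 ≤ ∑ f ∈ D.erase e, c f • f := Finset.sum_nonneg fun f hf =>
        smul_nonneg (hc0 f (Finset.mem_of_mem_erase hf)) (hD.1 f (Finset.mem_of_mem_erase hf)).le
      rw [add_smul]
      have h4 := le_sub_iff_add_le.1 h1
      refine le_trans ?_ h4
      rw [add_comm, ← add_assoc]
      exact le_add_of_nonneg_right h3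
    have h5 : c e + s ≤ c e := le_csSup (hb e he) h2
    have h6 : s = 0 := by linarith
    rw [hs, h6, zero_smul]
  have hy : x - ∑ e ∈ D, c e • e = 0 := by
    by_contra hne
    have h1 := hD.insert (lt_of_le_of_ne hy0 (Ne.symm hne)) hyd
    have h2 := hmax _ h1.1
    omega
  refine ⟨fun e => if e ∈ D then c e else 0, fun e => ?_, ?_⟩
  · dsimp only
    split_ifs with h
    exacts [hc0 e h, le_rfl]
  · rw [sub_eq_zero.1 hy]
    exact Finset.sum_congr rfl fun e he => by simp only [if_pos he]

variable (L) in
/-- A finite-dimensional Banach lattice has a basis for which the order is coordinatewise. -/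
theorem exists_basis_nonneg_iff [FiniteDimensional ℝ L] :
    ∃ (m : ℕ) (b : Module.Basis (Fin m) ℝ L), ∀ x, 0 ≤ x ↔ ∀ i, 0 ≤ b.repr x i := by
  classical
  obtain ⟨D, hD, hmax⟩ := exists_maximal_isDisjointSystem (L := L)
  have hspan : ∀ x : L, 0 ≤ x → x ∈ Submodule.span ℝ (Set.range ((↑) : D → L)) := by
    intro x hx
    obtain ⟨c, -, rfl⟩ := mem_span_of_maximal hD hmax hx
    exact Submodule.sum_mem _ fun e he => Submodule.smul_mem _ _
      (Submodule.subset_span ⟨⟨e, he⟩, rfl⟩)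
  have htop : ⊤ ≤ Submodule.span ℝ (Set.range ((↑) : D → L)) := fun x _ => by
    rw [← posPart_sub_negPart x]
    exact Submodule.sub_mem _ (hspan _ (posPart_nonneg x)) (hspan _ (negPart_nonneg x))
  let b := Module.Basis.mk hD.linearIndepOn htop
  have hb : ∀ e : D, b e = e := fun e => by simp [b]
  refine ⟨D.card, b.reindex D.equivFin, fun x => ⟨fun hx i => ?_, fun hx => ?_⟩⟩
  · obtain ⟨c, hc0, hc⟩ := mem_span_of_maximal hD hmax hx
    have : x = ∑ e : D, c e • b e := by
      rw [hc, ← Finset.sum_coe_sort]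
      simp [hb]
    rw [this]
    simp only [Module.Basis.repr_reindex_apply, Module.Basis.repr_sum_self]
    exact hc0 _
  · rw [← (b.reindex D.equivFin).sum_repr x]
    refine Finset.sum_nonneg fun i _ => smul_nonneg (hx i) ?_
    rw [Module.Basis.reindex_apply, hb]
    exact (hD.1 _ (Subtype.coe_prop _)).le

end FiniteDimensionalLattice

/-! ### Coordinates and modulus over `𝕜`. -/

section Complexification

variable {𝕜 : Type v} [RCLike 𝕜]

lemma repr_latticeRe {L : Type*} [AddCommGroup L] [Module ℝ L] {m : ℕ}
    (b : Module.Basis (Fin m) ℝ L) (z : 𝕜 ⊗[ℝ] L) (i : Fin m) :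
    b.repr (latticeRe 𝕜 L z) i = RCLike.re ((Algebra.TensorProduct.basis 𝕜 b).repr z i) := by
  induction z with
  | zero => simp
  | add x y hx hy => simp [hx, hy]
  | tmul c x => simp [latticeRe, Algebra.TensorProduct.basis_repr_tmul, mul_comm]

lemma exists_norm_eq_one_mul_eq_norm (z : 𝕜) : ∃ a : 𝕜, ‖a‖ = 1 ∧ a * z = (‖z‖ : 𝕜) := by
  rcases eq_or_ne z 0 with rfl | hz
  · exact ⟨1, by simp, by simp⟩
  · refine ⟨(‖z‖ : 𝕜) / z, ?_, div_mul_cancel₀ _ hz⟩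
    rw [norm_div, RCLike.norm_ofReal, abs_norm, div_self (norm_ne_zero_iff.2 hz)]

/-- The order is coordinatewise: the vector of absolute values bounds all rotations of `z`, and one
suitable rotation attains it in the given coordinate. -/
lemma IsLatticeModulus.repr_eq {L : Type*} [AddCommGroup L] [Lattice L] [IsOrderedAddMonoid L]
    [Module ℝ L] {m : ℕ} {b : Module.Basis (Fin m) ℝ L}
    (hb : ∀ x, 0 ≤ x ↔ ∀ i, 0 ≤ b.repr x i) {z : 𝕜 ⊗[ℝ] L} {x : L} (h : IsLatticeModulus z x)
    (i : Fin m) : b.repr x i = ‖(Algebra.TensorProduct.basis 𝕜 b).repr z i‖ := by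
  have hle : ∀ x y, x ≤ y ↔ ∀ i, b.repr x i ≤ b.repr y i := fun x y => by
    rw [← sub_nonneg, hb]
    simp
  refine le_antisymm ?_ ?_
  · have hub : x ≤ b.equivFun.symm fun j => ‖(Algebra.TensorProduct.basis 𝕜 b).repr z j‖ := by
      refine h.2 ?_
      rintro _ ⟨a, ha, rfl⟩
      refine (hle _ _).2 fun j => ?_
      have : b.repr (b.equivFun.symm
          fun j => ‖(Algebra.TensorProduct.basis 𝕜 b).repr z j‖) j =
          ‖(Algebra.TensorProduct.basis 𝕜 b).repr z j‖ :=
        congrFun (b.equivFun.apply_symm_apply _) j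
      rw [this, repr_latticeRe, map_smul, Finsupp.smul_apply, smul_eq_mul]
      refine (RCLike.re_le_norm _).trans ?_
      rw [norm_mul, ha, one_mul]
    have h1 := (hle _ _).1 hub i
    have : b.repr (b.equivFun.symm
        fun j => ‖(Algebra.TensorProduct.basis 𝕜 b).repr z j‖) i =
        ‖(Algebra.TensorProduct.basis 𝕜 b).repr z i‖ :=
      congrFun (b.equivFun.apply_symm_apply _) i
    rwa [this] at h1
  · obtain ⟨a, ha, haz⟩ :=
      exists_norm_eq_one_mul_eq_norm ((Algebra.TensorProduct.basis 𝕜 b).repr z i)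
    have h1 := (hle _ _).1 (h.1 ⟨a, ha, rfl⟩) i
    rw [repr_latticeRe, map_smul, Finsupp.smul_apply, smul_eq_mul, haz,
      RCLike.ofReal_re] at h1
    exact h1

/-- A finite-dimensional Banach lattice has a 1-unconditional coordinate system. -/
theorem IsFinDimBanachLattice.exists_equiv {Z : Type*} [NormedAddCommGroup Z] [NormedSpace 𝕜 Z]
    (hZ : IsFinDimBanachLattice 𝕜 Z) : ∃ (m : ℕ) (φ : Z ≃ₗ[𝕜] (Fin m → 𝕜)),
      ∀ y z, (∀ i, ‖φ y i‖ ≤ ‖φ z i‖) → ‖y‖ ≤ ‖z‖ := by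
  obtain ⟨L, _, _, _, _, _, _, _, e, he⟩ := hZ
  obtain ⟨m, b, hb⟩ := exists_basis_nonneg_iff L
  refine ⟨m, e.trans (Algebra.TensorProduct.basis 𝕜 b).equivFun, fun y z hyz => ?_⟩
  obtain ⟨p, hp, hpy⟩ := he y
  obtain ⟨q, hq, hqz⟩ := he z
  rw [hpy, hqz]
  have hp0 : 0 ≤ p := (hb p).2 fun i => by rw [hp.repr_eq hb]; exact norm_nonneg _
  have hpq : p ≤ q := by
    rw [← sub_nonneg, hb]
    intro i
    rw [map_sub, Finsupp.sub_apply, hp.repr_eq hb, hq.repr_eq hb, sub_nonneg]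
    exact hyz i
  refine norm_le_norm_of_abs_le_abs ?_
  rwa [abs_of_nonneg hp0, abs_of_nonneg (hp0.trans hpq)]

end Complexification

/-! ### Finite frames from local unconditional structure. -/

section FiniteFrame

variable {𝕜 : Type v} [RCLike 𝕜] {X : Type u} [NormedAddCommGroup X] [NormedSpace 𝕜 X]

lemma map_signSum {ι M M' F : Type*} [DecidableEq ι] [AddCommGroup M] [AddCommGroup M']
    [FunLike F M M'] [AddMonoidHomClass F M M'] (f : F) (s t : Finset ι) (a : ι → M) :
    f (signSum s t a) = signSum s t fun n => f (a n) := by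
  simp only [signSum, map_sum]
  exact Finset.sum_congr rfl fun n _ => by split_ifs <;> simp

lemma norm_signSum_le {ι : Type*} [DecidableEq ι] (s t : Finset ι) (a : ι → X) {M : ℝ}
    (h : ∀ S : Finset ι, ‖∑ n ∈ S, a n‖ ≤ M) : ‖signSum s t a‖ ≤ 2 * M := by
  have : signSum s t a = ∑ n ∈ s.filter (· ∈ t), a n - ∑ n ∈ s.filter (· ∉ t), a n := by
    rw [signSum, Finset.sum_ite, Finset.sum_neg_distrib, sub_eq_add_neg]
  rw [this]
  refine (norm_sub_le _ _).trans ?_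
  linarith [h (s.filter (· ∈ t)), h (s.filter (· ∉ t))]

/-- If the norm of `Z` is 1-unconditional, then `∑ ‖uᵢ‖ ‖g (eᵢ)‖ ≤ ‖g‖ ‖u‖`. -/
lemma sum_norm_coord_mul_norm_le {Z : Type*} [NormedAddCommGroup Z] [NormedSpace 𝕜 Z] {m : ℕ}
    (φ : Z ≃ₗ[𝕜] (Fin m → 𝕜)) (hφ : ∀ y z, (∀ i, ‖φ y i‖ ≤ ‖φ z i‖) → ‖y‖ ≤ ‖z‖)
    (g : Z →L[𝕜] 𝕜) (u : Z) :
    ∑ i, ‖φ u i‖ * ‖g (φ.symm (Pi.single i 1))‖ ≤ ‖g‖ * ‖u‖ := by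
  choose μ hμ1 hμ using fun i =>
    exists_norm_eq_one_mul_eq_norm (φ u i * g (φ.symm (Pi.single i 1)))
  -- Rotating the coordinates of `u` makes every contribution to `g z` nonnegative without
  -- increasing the norm.
  set z : Z := φ.symm fun i => μ i * φ u i with hz
  have hzφ : φ z = fun i => μ i * φ u i := φ.apply_symm_apply _
  have h1 : ‖z‖ ≤ ‖u‖ := hφ _ _ fun i => by rw [hzφ, norm_mul, hμ1, one_mul]
  have h2 : g z = ((∑ i, ‖φ u i‖ * ‖g (φ.symm (Pi.single i 1))‖ : ℝ) : 𝕜) := by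
    have : z = ∑ i, (μ i * φ u i) • φ.symm (Pi.single i 1) := by
      apply φ.injective
      rw [hzφ]
      ext j
      simp [Finset.sum_apply, Pi.single_apply]
    rw [this]
    simp only [map_sum, map_smul, smul_eq_mul, mul_assoc, hμ, norm_mul]
  have h3 := g.le_opNorm z
  rw [h2, RCLike.norm_ofReal, abs_of_nonneg (by positivity)] at h3
  exact h3.trans (by gcongr)

/-- The local unconditional structure of `X` turns the decomposition into finite frames: rank one
operators on the summands whose sums are, up to `N`, uniformly unconditionally bounded. -/
theorem IsProjectionSystem.exists_finite_frame {E : ℕ → Submodule 𝕜 X} {Q : ∀ n, X →L[𝕜] E n}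
    {K : ℝ} (hQ : IsProjectionSystem E Q K) (hE : ∀ n, FiniteDimensional 𝕜 (E n))
    (hX : HasLUST 𝕜 X) : ∃ C : ℝ, 0 ≤ C ∧ ∀ N : ℕ, ∃ (m : ℕ) (a : ∀ n, Fin m → (E n →L[𝕜] 𝕜))
      (b : ∀ n, Fin m → E n), (∀ n < N, ∀ x : E n, ∑ i, a n i x • b n i = x) ∧
      ∀ (l : ℕ → Fin m → 𝕜), (∀ n i, ‖l n i‖ ≤ 1) → ∀ x : X,
        ‖∑ n ∈ Finset.range N, ∑ i, (l n i * a n i (Q n x)) • (b n i : X)‖ ≤ C * ‖x‖ := by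
  obtain ⟨C, hC⟩ := hX
  have hK := hQ.nonneg
  -- The constant is `4` from two uses of Khintchine, `2K` for each of two signed sums of
  -- projections, `K` for extending `A` to `X` through the partial sum projection, and `|C|` for
  -- `‖A‖ * ‖B‖`.
  refine ⟨16 * K ^ 3 * |C|, by positivity, fun N => ?_⟩
  have hF : FiniteDimensional 𝕜 ((Finset.range N).sup E : Submodule 𝕜 X) :=
    Submodule.finiteDimensional_finset_sup _ _
  obtain ⟨Z, _, _, A, B, hZ, hAB, hBA⟩ := hC _ hF
  obtain ⟨m, φ, hφ⟩ := hZ.exists_equiv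
  have hZfin : FiniteDimensional 𝕜 Z := φ.symm.finiteDimensional
  let T : X →L[𝕜] X := ∑ n ∈ Finset.range N, (E n).subtypeL.comp (Q n)
  have hT : ∀ x, T x = ∑ n ∈ Finset.range N, (Q n x : X) := fun x => by simp [T]
  have hTE : ∀ n < N, ∀ x ∈ E n, T x = x := by
    intro n hn x hx
    rw [hT, Finset.sum_eq_single n]
    · exact congrArg Subtype.val (hQ.apply_self n ⟨x, hx⟩)
    · intro k _ hk
      rw [hQ.apply_of_ne k n hk.symm x hx]; rfl
    · intro h
      exact absurd (Finset.mem_range.2 hn) h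
  have hTmem : ∀ x, T x ∈ (Finset.range N).sup E := fun x => by
    rw [hT]
    exact Submodule.sum_mem _ fun n hn => Finset.le_sup (f := E) hn (Q n x).2
  let A' : X →L[𝕜] Z := A.comp (T.codRestrict _ hTmem)
  have hBA' : ∀ x, B (A' x) = T x := fun x => hBA _
  have hA'norm : ∀ x, ‖A' x‖ ≤ ‖A‖ * (K * ‖x‖) := fun x => by
    refine (A.le_opNorm _).trans ?_
    gcongr
    change ‖T x‖ ≤ _
    rw [hT]
    exact hQ.norm_sum_proj_le _ _
  let coord : Fin m → Z →L[𝕜] 𝕜 := fun i =>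
    LinearMap.toContinuousLinearMap ((LinearMap.proj i).comp φ.toLinearMap)
  have hcoord : ∀ i z, coord i z = φ z i := fun i z => rfl
  let e : Fin m → Z := fun i => φ.symm (Pi.single i 1)
  have hexp : ∀ z : Z, ∑ i, φ z i • e i = z := fun z => by
    apply φ.injective
    ext j
    simp [e, Finset.sum_apply, Pi.single_apply]
  refine ⟨m, fun n i => (coord i).comp (A'.comp (E n).subtypeL), fun n i => Q n (B (e i)),
    fun n hn x => ?_, fun l hl x => ?_⟩
  · have : ∑ i, φ (A' x) i • Q n (B (e i)) = Q n (B (∑ i, φ (A' x) i • e i)) := by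
      simp only [map_sum, map_smul]
    refine this.trans ?_
    rw [hexp, hBA', hTE n hn x x.2, hQ.apply_self]
  set y := ∑ n ∈ Finset.range N, ∑ i, (l n i * φ (A' (Q n x)) i) • (Q n (B (e i)) : X) with hy
  change ‖y‖ ≤ _
  obtain ⟨f, hf1, hf⟩ := exists_dual_vector'' 𝕜 y
  have hsign : ∀ (t : Finset ℕ) (z : X),
      ‖signSum (Finset.range N) t fun n => (Q n z : X)‖ ≤ 2 * (K * ‖z‖) := fun t z =>
    norm_signSum_le _ _ _ fun S => hQ.norm_sum_proj_le S z
  have hD : ∀ t t' : Finset ℕ,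
      ∑ i, ‖signSum (Finset.range N) t fun n => φ (A' (Q n x)) i‖ *
        ‖signSum (Finset.range N) t' fun n => f (Q n (B (e i)))‖ ≤
        4 * K ^ 3 * |C| * ‖x‖ := by
    intro t t'
    let S' : X →L[𝕜] X := signSum (Finset.range N) t' fun n => (E n).subtypeL.comp (Q n)
    have hS' : ∀ z, S' z = signSum (Finset.range N) t' fun n => (Q n z : X) := fun z =>
      map_signSum (ContinuousLinearMap.apply 𝕜 X z) _ _ _
    have h1 := sum_norm_coord_mul_norm_le φ hφ (f.comp (S'.comp B))
      (A' (signSum (Finset.range N) t fun n => (Q n x : X)))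
    have h2 : ∀ i, φ (A' (signSum (Finset.range N) t fun n => (Q n x : X))) i =
        signSum (Finset.range N) t fun n => φ (A' (Q n x)) i := fun i =>
      map_signSum ((coord i).comp A') _ _ _
    have h3 : ∀ i, (f.comp (S'.comp B)) (φ.symm (Pi.single i 1)) =
        signSum (Finset.range N) t' fun n => f (Q n (B (e i))) := fun i => by
      change f (S' (B (e i))) = _
      rw [hS', map_signSum]
    simp only [h2, h3] at h1
    refine h1.trans ?_
    have h4 : ‖f.comp (S'.comp B)‖ ≤ 2 * K * ‖B‖ := by
      refine ContinuousLinearMap.opNorm_le_bound _ (by positivity) fun z => ?_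
      calc ‖f (S' (B z))‖ ≤ ‖f‖ * ‖S' (B z)‖ := f.le_opNorm _
        _ ≤ 1 * (2 * (K * (‖B‖ * ‖z‖))) := by
          gcongr
          rw [hS']
          refine (hsign _ _).trans ?_
          gcongr
          exact B.le_opNorm z
        _ = _ := by ring
    calc _ ≤ (2 * K * ‖B‖) * (‖A‖ * (K * (2 * (K * ‖x‖)))) := by
          gcongr
          refine (hA'norm _).trans ?_
          gcongr
          exact hsign _ _
      _ = 4 * K ^ 3 * (‖A‖ * ‖B‖) * ‖x‖ := by ring
      _ ≤ _ := by
        gcongr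
        exact hAB.trans (le_abs_self C)
  have hyle : ‖y‖ ≤ ∑ i, ∑ n ∈ Finset.range N,
      ‖φ (A' (Q n x)) i‖ * ‖f (Q n (B (e i)))‖ := by
    have h1 : ‖f y‖ = ‖y‖ := by rw [hf, RCLike.norm_ofReal, abs_norm]
    rw [← h1, hy, Finset.sum_comm, map_sum]
    refine (norm_sum_le _ _).trans (Finset.sum_le_sum fun i _ => ?_)
    rw [map_sum]
    refine (norm_sum_le _ _).trans (Finset.sum_le_sum fun n _ => ?_)
    rw [map_smul, smul_eq_mul, norm_mul, norm_mul]
    gcongr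
    exact mul_le_of_le_one_left (norm_nonneg _) (hl n i)
  -- There are `4 ^ N` pairs of sign choices, and `hD` bounds the term of each pair separately.
  have hfin : 4 ^ N * ‖y‖ ≤ 4 ^ N * (16 * K ^ 3 * |C| * ‖x‖) := by
    calc 4 ^ N * ‖y‖ ≤ ∑ i, 4 ^ (Finset.range N).card * ∑ n ∈ Finset.range N,
          ‖φ (A' (Q n x)) i‖ * ‖f (Q n (B (e i)))‖ := by
          rw [← Finset.mul_sum, Finset.card_range]
          gcongr
      _ ≤ ∑ i, 4 * ∑ t ∈ (Finset.range N).powerset, ∑ t' ∈ (Finset.range N).powerset,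
          ‖signSum (Finset.range N) t fun n => φ (A' (Q n x)) i‖ *
          ‖signSum (Finset.range N) t' fun n => f (Q n (B (e i)))‖ :=
        Finset.sum_le_sum fun i _ => sum_norm_mul_norm_le _ _ _
      _ = 4 * ∑ t ∈ (Finset.range N).powerset, ∑ t' ∈ (Finset.range N).powerset, ∑ i,
          ‖signSum (Finset.range N) t fun n => φ (A' (Q n x)) i‖ *
          ‖signSum (Finset.range N) t' fun n => f (Q n (B (e i)))‖ := by
        rw [← Finset.mul_sum, Finset.sum_comm]
        congr 1
        refine Finset.sum_congr rfl fun t _ => Finset.sum_comm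
      _ ≤ 4 * ∑ t ∈ (Finset.range N).powerset, ∑ t' ∈ (Finset.range N).powerset,
          4 * K ^ 3 * |C| * ‖x‖ := by
        gcongr
        exact hD _ _
      _ = _ := by
        have : (4 : ℝ) ^ N = 2 ^ N * 2 ^ N := by rw [← mul_pow]; norm_num
        simp only [Finset.sum_const, Finset.card_powerset, Finset.card_range, nsmul_eq_mul, this]
        push_cast
        ring
  exact le_of_mul_le_mul_left hfin (by positivity)

end FiniteFrame

/-! ### Frames indexed by dual nets, and their limit. -/

section Discretization

variable {𝕜 : Type v} [RCLike 𝕜]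

section FiniteDimensionalSpace

variable (F : Type*) [NormedAddCommGroup F] [NormedSpace 𝕜 F] [FiniteDimensional 𝕜 F]

lemma exists_finset_net {η : ℝ} (hη : 0 < η) : ∃ D : Finset (F →L[𝕜] 𝕜),
    ∀ f : F →L[𝕜] 𝕜, ∃ γ ∈ D, ‖f - (‖f‖ : 𝕜) • γ‖ ≤ η * ‖f‖ := by
  have : ProperSpace (F →L[𝕜] 𝕜) := FiniteDimensional.proper 𝕜 _
  obtain ⟨t, -, htf, hcov⟩ :=
    finite_cover_balls_of_compact (isCompact_closedBall (0 : F →L[𝕜] 𝕜) 1) hη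
  refine ⟨htf.toFinset, fun f => ?_⟩
  have hmem : ((‖f‖ : 𝕜)⁻¹) • f ∈ Metric.closedBall (0 : F →L[𝕜] 𝕜) 1 := by
    rw [mem_closedBall_zero_iff, norm_smul, norm_inv, RCLike.norm_ofReal, abs_norm]
    exact inv_mul_le_one
  obtain ⟨γ, hγt, hγ⟩ := Set.mem_iUnion₂.1 (hcov hmem)
  refine ⟨γ, htf.mem_toFinset.2 hγt, ?_⟩
  rcases eq_or_ne f 0 with rfl | hf
  · have h0 : ((‖(0 : F →L[𝕜] 𝕜)‖ : ℝ) : 𝕜) • γ = 0 := by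
      rw [norm_zero, RCLike.ofReal_zero]
      exact zero_smul 𝕜 γ
    rw [h0]
    simp
  have hf' : (‖f‖ : 𝕜) ≠ 0 := by simpa using hf
  have : f - (‖f‖ : 𝕜) • γ = (‖f‖ : 𝕜) • ((‖f‖ : 𝕜)⁻¹ • f - γ) := by
    rw [smul_sub, smul_inv_smul₀ hf']
  rw [this, norm_smul, RCLike.norm_ofReal, abs_norm, mul_comm]
  gcongr
  rw [← dist_eq_norm]
  exact (Metric.mem_ball.1 hγ).le

variable (𝕜) in
lemma exists_norming_vectors : ∃ (d : ℕ) (z : Fin d → F), ∀ f : F →L[𝕜] 𝕜,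
    ‖f‖ ≤ ∑ k, ‖f (z k)‖ := by
  obtain ⟨M, hM, h⟩ := (Module.finBasis 𝕜 F).exists_opNorm_le (F := 𝕜)
  refine ⟨_, fun k => (M : 𝕜) • Module.finBasis 𝕜 F k, fun f => ?_⟩
  have h1 : ‖f‖ ≤ M * ∑ k, ‖f (Module.finBasis 𝕜 F k)‖ :=
    h (by positivity) fun k => Finset.single_le_sum
      (f := fun k => ‖f (Module.finBasis 𝕜 F k)‖) (fun _ _ => norm_nonneg _) (Finset.mem_univ k)
  refine h1.trans (le_of_eq ?_)
  simp [Finset.mul_sum, abs_of_pos hM]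

end FiniteDimensionalSpace

/-- Since `‖a i‖ ≤ ∑ k, ‖a i (z k)‖`, one can write `θ i = r * ∑ k, μ k i * a i (z k)` with
multipliers `μ` of modulus at most one. The hypothesis then applies at each `z k`. Thus coefficients
only comparable to `‖a i‖`, not of the form `l i * a i x`, are controlled too. -/
lemma norm_sum_smul_le_of_norm_le {F : Type*} [NormedAddCommGroup F] [NormedSpace 𝕜 F] {m d : ℕ}
    {a : Fin m → (F →L[𝕜] 𝕜)} {b : Fin m → F} {C : ℝ}
    (h : ∀ l : Fin m → 𝕜, (∀ i, ‖l i‖ ≤ 1) → ∀ x, ‖∑ i, (l i * a i x) • b i‖ ≤ C * ‖x‖)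
    {z : Fin d → F} (hz : ∀ f : F →L[𝕜] 𝕜, ‖f‖ ≤ ∑ k, ‖f (z k)‖) {r : ℝ} (hr : 0 ≤ r)
    {θ : Fin m → 𝕜} (hθ : ∀ i, ‖θ i‖ ≤ r * ‖a i‖) :
    ‖∑ i, θ i • b i‖ ≤ r * (C * ∑ k, ‖z k‖) := by
  set S : Fin m → ℝ := fun i => ∑ k, ‖a i (z k)‖ with hS
  have hS0 : ∀ i, 0 ≤ S i := fun i => Finset.sum_nonneg fun k _ => norm_nonneg _
  have hθS : ∀ i, ‖θ i‖ ≤ r * S i := fun i => (hθ i).trans (by gcongr; exact hz _)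
  choose ν hν1 hν using fun i k => exists_norm_eq_one_mul_eq_norm (a i (z k))
  set μ : Fin d → Fin m → 𝕜 := fun k i => θ i / ((r * S i : ℝ) : 𝕜) * ν i k with hμ
  have hμ1 : ∀ k i, ‖μ k i‖ ≤ 1 := fun k i => by
    rw [norm_mul, hν1, mul_one, norm_div, RCLike.norm_ofReal,
      abs_of_nonneg (mul_nonneg hr (hS0 i))]
    exact div_le_one_of_le₀ (hθS i) (mul_nonneg hr (hS0 i))
  have hθμ : ∀ i, θ i = r * ∑ k, μ k i * a i (z k) := fun i => by
    have h1 : ∑ k, μ k i * a i (z k) = θ i / ((r * S i : ℝ) : 𝕜) * (S i : 𝕜) := by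
      simp only [hμ, mul_assoc, hν, hS]
      rw [← Finset.mul_sum]
      push_cast
      rfl
    rw [h1]
    by_cases h0 : r * S i = 0
    · have : θ i = 0 := norm_le_zero_iff.1 (h0 ▸ hθS i)
      simp [this]
    · have h0' : ((r * S i : ℝ) : 𝕜) ≠ 0 := by exact_mod_cast h0
      rw [mul_left_comm, ← RCLike.ofReal_mul, div_mul_cancel₀ _ h0']
  have h2 : ∑ i, θ i • b i = (r : 𝕜) • ∑ k, ∑ i, (μ k i * a i (z k)) • b i := by
    rw [Finset.sum_comm, Finset.smul_sum]
    refine Finset.sum_congr rfl fun i _ => ?_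
    rw [← Finset.sum_smul, smul_smul, ← hθμ]
  rw [h2, norm_smul, RCLike.norm_ofReal, abs_of_nonneg hr]
  gcongr
  rw [Finset.mul_sum]
  exact (norm_sum_le _ _).trans (Finset.sum_le_sum fun k _ => h _ (hμ1 k) _)

variable {X : Type u} [NormedAddCommGroup X] [NormedSpace 𝕜 X]

lemma IsProjectionSystem.norm_proj_le {E : ℕ → Submodule 𝕜 X} {Q : ∀ n, X →L[𝕜] E n} {K : ℝ}
    (hQ : IsProjectionSystem E Q K) (n : ℕ) (x : X) : ‖Q n x‖ ≤ K * ‖x‖ := by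
  simpa using hQ.norm_sum_proj_le {n} x

/-- Merging the rank one operators of a finite frame along nets of the dual balls. -/
lemma IsProjectionSystem.exists_merged_frame {E : ℕ → Submodule 𝕜 X} {Q : ∀ n, X →L[𝕜] E n}
    {K : ℝ} (hQ : IsProjectionSystem E Q K) {C : ℝ} {N m : ℕ}
    {a : ∀ n, Fin m → (E n →L[𝕜] 𝕜)} {b : ∀ n, Fin m → E n}
    (hab : ∀ n < N, ∀ x : E n, ∑ i, a n i x • b n i = x)
    (hbd : ∀ (l : ℕ → Fin m → 𝕜), (∀ n i, ‖l n i‖ ≤ 1) → ∀ x : X,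
      ‖∑ n ∈ Finset.range N, ∑ i, (l n i * a n i (Q n x)) • (b n i : X)‖ ≤ C * ‖x‖)
    {d : ℕ → ℕ} {z : ∀ n, Fin (d n) → E n}
    (hz : ∀ n (f : E n →L[𝕜] 𝕜), ‖f‖ ≤ ∑ k, ‖f (z n k)‖)
    {δ : ℕ → ℝ} (hδ : ∀ n, 0 ≤ δ n) (hδs : ∀ N, ∑ n ∈ Finset.range N, δ n ≤ 1)
    {η : ℕ → ℝ} (hη : ∀ n, 0 ≤ η n) (hηδ : ∀ n, η n * (C * ∑ k, ‖z n k‖) ≤ δ n)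
    {D : ∀ n, Finset (E n →L[𝕜] 𝕜)}
    (hD : ∀ n, ∀ f : E n →L[𝕜] 𝕜, ∃ γ ∈ D n, ‖f - (‖f‖ : 𝕜) • γ‖ ≤ η n * ‖f‖) :
    ∃ b' : ∀ n, (E n →L[𝕜] 𝕜) → E n, (∀ n < N, ∀ c, ‖b' n c‖ ≤ C * ∑ k, ‖z n k‖) ∧
      (∀ n < N, ∀ x : E n, ‖∑ c ∈ D n, c x • b' n c - x‖ ≤ δ n * ‖x‖) ∧
      ∀ (l : ∀ n, (E n →L[𝕜] 𝕜) → 𝕜), (∀ n c, ‖l n c‖ ≤ 1) → ∀ x : X,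
        ‖∑ n ∈ Finset.range N, ∑ c ∈ D n, (l n c * c (Q n x)) • (b' n c : X)‖ ≤
          (C + K) * ‖x‖ := by
  classical
  have hblock : ∀ n < N, ∀ l : Fin m → 𝕜, (∀ i, ‖l i‖ ≤ 1) → ∀ x : E n,
      ‖∑ i, (l i * a n i x) • b n i‖ ≤ C * ‖x‖ := by
    intro n hn l hl x
    have h1 := hbd (Pi.single n l) (fun k i => by
      rcases eq_or_ne k n with rfl | h
      · simpa using hl i
      · simp [Pi.single_eq_of_ne h]) x
    rw [Finset.sum_eq_single n (fun k _ hk => by simp [Pi.single_eq_of_ne hk])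
      (fun h => absurd (Finset.mem_range.2 hn) h)] at h1
    simp only [Pi.single_eq_same, hQ.apply_self] at h1
    refine le_trans (le_of_eq ?_) h1
    rw [← Submodule.norm_coe]
    simp
  choose γ hγD hγ using fun n i => hD n (a n i)
  -- All indices whose functional is rounded to the net point `c` are collected into one vector.
  set b' : ∀ n, (E n →L[𝕜] 𝕜) → E n := fun n c =>
    ∑ i, (if γ n i = c then (‖a n i‖ : 𝕜) else 0) • b n i with hb'
  have hsum : ∀ n (l : (E n →L[𝕜] 𝕜) → 𝕜) (x : E n), ∑ c ∈ D n, (l c * c x) • b' n c =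
      ∑ i, (l (γ n i) * (‖a n i‖ * γ n i x)) • b n i := by
    intro n l x
    simp only [hb', Finset.smul_sum]
    rw [Finset.sum_comm]
    refine Finset.sum_congr rfl fun i _ => ?_
    rw [Finset.sum_eq_single (γ n i)]
    · rw [if_pos rfl, smul_smul]
      congr 1
      ring
    · intro c _ hc
      rw [if_neg hc.symm]
      simp
    · exact fun h => absurd (hγD n i) h
  have hdiff : ∀ n < N, ∀ l : (E n →L[𝕜] 𝕜) → 𝕜, (∀ c, ‖l c‖ ≤ 1) → ∀ x : E n,
      ‖∑ c ∈ D n, (l c * c x) • b' n c - ∑ i, (l (γ n i) * a n i x) • b n i‖ ≤ δ n * ‖x‖ := by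
    intro n hn l hl x
    rw [hsum, ← Finset.sum_sub_distrib]
    simp only [← sub_smul]
    refine (norm_sum_smul_le_of_norm_le (hblock n hn) (hz n)
      (mul_nonneg (hη n) (norm_nonneg x)) fun i => ?_).trans ?_
    · rw [← mul_sub, norm_mul]
      calc _ ≤ 1 * ‖(a n i - (‖a n i‖ : 𝕜) • γ n i) x‖ := by
            gcongr
            · exact hl _
            · rw [← norm_neg]
              simp
        _ ≤ 1 * ((η n * ‖a n i‖) * ‖x‖) := by
            gcongr
            refine (ContinuousLinearMap.le_opNorm _ _).trans ?_
            gcongr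
            exact hγ n i
        _ = _ := by ring
    · calc _ = (η n * (C * ∑ k, ‖z n k‖)) * ‖x‖ := by ring
        _ ≤ _ := by
          gcongr
          exact hηδ n
  refine ⟨b', fun n hn c => ?_, fun n hn x => ?_, fun l hl x => ?_⟩
  · refine (norm_sum_smul_le_of_norm_le (hblock n hn) (hz n) zero_le_one fun i => ?_).trans
      (le_of_eq (one_mul _))
    split_ifs
    · simp
    · simp
  · have := hdiff n hn (fun _ => 1) (fun _ => by simp) x
    simpa only [one_mul, hab n hn] using this
  · set l' : ℕ → Fin m → 𝕜 := fun n i => l n (γ n i)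
    have h1 := hbd l' (fun n i => hl _ _) x
    have h2 : ‖∑ n ∈ Finset.range N, ∑ c ∈ D n, (l n c * c (Q n x)) • (b' n c : X) -
        ∑ n ∈ Finset.range N, ∑ i, (l' n i * a n i (Q n x)) • (b n i : X)‖ ≤ K * ‖x‖ := by
      rw [← Finset.sum_sub_distrib]
      calc _ ≤ ∑ n ∈ Finset.range N, δ n * (K * ‖x‖) := by
            refine (norm_sum_le _ _).trans (Finset.sum_le_sum fun n hn => ?_)
            have h3 := hdiff n (Finset.mem_range.1 hn) (l n) (hl n) (Q n x)
            rw [← Submodule.norm_coe] at h3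
            push_cast at h3
            refine h3.trans ?_
            gcongr
            · exact hδ n
            · exact hQ.norm_proj_le n x
        _ ≤ 1 * (K * ‖x‖) := by
            rw [← Finset.sum_mul]
            have := hQ.nonneg
            gcongr
            exact hδs N
        _ = _ := one_mul _
    calc _ ≤ C * ‖x‖ + K * ‖x‖ := by
          refine (norm_le_norm_add_norm_sub' _ _).trans (add_le_add h1 h2)
      _ = _ := by ring

/-- In the presence of local unconditional structure, the decomposition admits a finite
approximate frame in each summand, such that all these frames together are unconditionally
bounded. -/
theorem IsProjectionSystem.exists_approximate_frame {E : ℕ → Submodule 𝕜 X}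
    {Q : ∀ n, X →L[𝕜] E n} {K : ℝ} (hQ : IsProjectionSystem E Q K)
    (hE : ∀ n, FiniteDimensional 𝕜 (E n)) (hX : HasLUST 𝕜 X) {δ : ℕ → ℝ} (hδ : ∀ n, 0 < δ n)
    (hδs : ∀ N, ∑ n ∈ Finset.range N, δ n ≤ 1) :
    ∃ (C : ℝ) (D : ∀ n, Finset (E n →L[𝕜] 𝕜)) (b : ∀ n, (E n →L[𝕜] 𝕜) → E n), 0 ≤ C ∧
      (∀ n, (D n).Nonempty) ∧
      (∀ n (x : E n), ‖∑ c ∈ D n, c x • b n c - x‖ ≤ δ n * ‖x‖) ∧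
      ∀ (l : ∀ n, (E n →L[𝕜] 𝕜) → 𝕜), (∀ n c, ‖l n c‖ ≤ 1) → ∀ N (x : X),
        ‖∑ n ∈ Finset.range N, ∑ c ∈ D n, (l n c * c (Q n x)) • (b n c : X)‖ ≤ C * ‖x‖ := by
  obtain ⟨C, hC, h⟩ := hQ.exists_finite_frame hE hX
  choose d z hz using fun n => exists_norming_vectors 𝕜 (E n)
  set G : ℕ → ℝ := fun n => C * ∑ k, ‖z n k‖ with hG
  have hG0 : ∀ n, 0 ≤ G n := fun n =>
    mul_nonneg hC (Finset.sum_nonneg fun k _ => norm_nonneg _)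
  -- Mesh chosen so that the rounding error, amplified by `G n`, is at most `δ n`; the `+ 1` covers
  -- `G n = 0`.
  have hη : ∀ n, 0 < δ n / (G n + 1) := fun n => div_pos (hδ n) (by linarith [hG0 n])
  choose D hD using fun n => exists_finset_net (𝕜 := 𝕜) (E n) (hη n)
  choose m a b hab hbd using h
  choose b' hb'1 hb'2 hb'3 using fun N => hQ.exists_merged_frame (hab N) (hbd N) hz
    (fun n => (hδ n).le) hδs (fun n => (hη n).le) (fun n => by
      rw [div_mul_eq_mul_div, div_le_iff₀ (by linarith [hG0 n])]
      exact mul_le_mul_of_nonneg_left (by linarith [hG0 n]) (hδ n).le) hD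
  -- The nets do not depend on `N`, so one ultrafilter gives limits for all `n` and `c` at once.
  let U : Ultrafilter ℕ := hyperfilter ℕ
  have hUle : (U : Filter ℕ) ≤ atTop := Nat.hyperfilter_le_atTop
  have hlim : ∀ n c, ∃ y : E n, Tendsto (fun N => b' N n c) U (𝓝 y) := by
    intro n c
    have : ProperSpace (E n) := FiniteDimensional.proper 𝕜 _
    have hmem : ∀ᶠ N in (U : Filter ℕ), b' N n c ∈ Metric.closedBall (0 : E n) (G n) := by
      refine ((eventually_gt_atTop n).mono fun N hN => ?_).filter_mono hUle
      rw [mem_closedBall_zero_iff]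
      exact hb'1 N n hN c
    obtain ⟨y, -, hy⟩ := (isCompact_closedBall (0 : E n) (G n)).ultrafilter_le_nhds
      (U.map fun N => b' N n c) (le_principal_iff.2 hmem)
    exact ⟨y, hy⟩
  choose β hβ using hlim
  have hβX : ∀ n c, Tendsto (fun N => (b' N n c : X)) U (𝓝 (β n c : X)) := fun n c =>
    (continuous_subtype_val.tendsto _).comp (hβ n c)
  have := hQ.nonneg
  refine ⟨C + K, D, β, by positivity, fun n => ?_, fun n x => ?_, fun l hl N x => ?_⟩
  -- Nonempty nets, even for a zero summand, keep the blocks nonempty and so their endpoints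
  -- strictly increasing.
  · obtain ⟨γ, hγ, -⟩ := hD n 0
    exact ⟨γ, hγ⟩
  · have ht : Tendsto (fun N => ‖∑ c ∈ D n, c x • b' N n c - x‖) U
        (𝓝 ‖∑ c ∈ D n, c x • β n c - x‖) :=
      ((tendsto_finsetSum _ fun c _ => (hβ n c).const_smul _).sub_const _).norm
    exact le_of_tendsto ht (((eventually_gt_atTop n).mono fun N hN => hb'2 N n hN x).filter_mono
      hUle)
  · have ht : Tendsto (fun N' => ‖∑ n ∈ Finset.range N, ∑ c ∈ D n,
        (l n c * c (Q n x)) • (b' N' n c : X)‖) U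
        (𝓝 ‖∑ n ∈ Finset.range N, ∑ c ∈ D n, (l n c * c (Q n x)) • (β n c : X)‖) :=
      (tendsto_finsetSum _ fun n _ => tendsto_finsetSum _ fun c _ =>
        (hβX n c).const_smul _).norm
    refine le_of_tendsto ht (((eventually_ge_atTop N).mono fun N' hN => ?_).filter_mono hUle)
    have h1 := hb'3 N' (fun n c => if n < N then l n c else 0) (fun n c => by
      split_ifs
      · exact hl n c
      · simp) x
    refine le_trans (le_of_eq ?_) h1
    congr 1
    rw [← Finset.sum_subset (Finset.range_mono hN)]
    · refine Finset.sum_congr rfl fun n hn => Finset.sum_congr rfl fun c _ => ?_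
      rw [if_pos (Finset.mem_range.1 hn)]
    · intro n _ hn
      refine Finset.sum_eq_zero fun c _ => ?_
      rw [if_neg (by simpa using hn)]
      simp

end Discretization

/-! ### Enumeration and exact block frames. -/

section BlockFrame

lemma exists_mem_Ico_of_strictMono {p : ℕ → ℕ} (hp : StrictMono p) (hp0 : p 0 = 0) (j : ℕ) :
    ∃ n, j ∈ Finset.Ico (p n) (p (n + 1)) := by
  have hex : ∃ n, j < p (n + 1) := ⟨j, (Nat.lt_succ_self j).trans_le (hp.id_le _)⟩
  refine ⟨Nat.find hex, Finset.mem_Ico.2 ⟨?_, Nat.find_spec hex⟩⟩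
  rcases h : Nat.find hex with _ | k
  · simp [hp0]
  · exact not_lt.1 (Nat.find_min hex (h ▸ Nat.lt_succ_self k))

/-- Finite nonempty sets can be enumerated consecutively, along consecutive blocks of `ℕ`. -/
lemma exists_block_enumeration {α : ℕ → Type*} [∀ n, DecidableEq (α n)] (D : ∀ n, Finset (α n))
    (hD : ∀ n, (D n).Nonempty) : ∃ (p : ℕ → ℕ) (σ : ℕ → Σ n, α n), StrictMono p ∧ p 0 = 0 ∧
      Function.Injective σ ∧
      ∀ n, (Finset.Ico (p n) (p (n + 1))).image σ = (D n).image (Sigma.mk n) := by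
  set p : ℕ → ℕ := fun n => ∑ k ∈ Finset.range n, (D k).card with hp
  have hps : ∀ n, p (n + 1) = p n + (D n).card := fun n => Finset.sum_range_succ _ _
  have hmono : StrictMono p := strictMono_nat_of_lt_succ fun n => by
    rw [hps]
    exact Nat.lt_add_of_pos_right (hD n).card_pos
  have hcard : ∀ n, (Finset.Ico (p n) (p (n + 1))).card = (D n).card := fun n => by
    rw [Nat.card_Ico, hps, Nat.add_sub_cancel_left]
  let f := fun n => Finset.equivOfCardEq (hcard n)
  choose ν hν using exists_mem_Ico_of_strictMono hmono (by simp [hp])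
  have huniq : ∀ n j, j ∈ Finset.Ico (p n) (p (n + 1)) → ν j = n := by
    intro n j hj
    obtain ⟨h1, h2⟩ := Finset.mem_Ico.1 hj
    obtain ⟨h3, h4⟩ := Finset.mem_Ico.1 (hν j)
    have h5 := hmono.lt_iff_lt.1 (h1.trans_lt h4)
    have h6 := hmono.lt_iff_lt.1 (h3.trans_lt h2)
    omega
  let σ : ℕ → Σ n, α n := fun j => ⟨ν j, f _ ⟨j, hν j⟩⟩
  have hσ : ∀ n j (hj : j ∈ Finset.Ico (p n) (p (n + 1))), σ j = ⟨n, f n ⟨j, hj⟩⟩ := by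
    intro n j hj
    obtain rfl := huniq n j hj
    rfl
  refine ⟨p, σ, hmono, by simp [hp], fun i j hij => ?_, fun n => ?_⟩
  · have hi := hσ _ i (hν i)
    have hn : ν i = ν j := congrArg Sigma.fst hij
    have hj := hσ (ν i) j (hn ▸ hν j)
    rw [hij, hj] at hi
    simp only [Sigma.mk.injEq, heq_eq_eq, true_and] at hi
    exact (congrArg Subtype.val ((f _).injective (Subtype.ext hi))).symm
  · ext s
    simp only [Finset.mem_image]
    constructor
    · rintro ⟨j, hj, rfl⟩
      exact ⟨_, (f n ⟨j, hj⟩).2, (hσ n j hj).symm⟩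
    · rintro ⟨c, hc, rfl⟩
      refine ⟨((f n).symm ⟨c, hc⟩ : ℕ), ((f n).symm ⟨c, hc⟩).2, ?_⟩
      rw [hσ n _ ((f n).symm ⟨c, hc⟩).2]
      simp

lemma sum_range_comp_eq_sum_blocks {M : Type*} [AddCommMonoid M] {p : ℕ → ℕ} (hp : Monotone p)
    (hp0 : p 0 = 0) (f : ℕ → M) (N : ℕ) :
    ∑ j ∈ Finset.range (p N), f j =
      ∑ n ∈ Finset.range N, ∑ j ∈ Finset.Ico (p n) (p (n + 1)), f j := by
  induction N with
  | zero => simp [hp0]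
  | succ N ih =>
    rw [Finset.sum_range_succ, ← ih, Finset.range_eq_Ico, Finset.range_eq_Ico,
      Finset.sum_Ico_consecutive _ (Nat.zero_le _) (hp (Nat.le_succ N))]

variable {𝕜 : Type v} [RCLike 𝕜] {X : Type u} [NormedAddCommGroup X] [NormedSpace 𝕜 X]

/-- An unconditional frame `(a, b)` of `X`, made up of consecutive finite blocks which are frames
of the subspaces `E n` and vanish on the other ones. -/
structure IsBlockFrame (E : ℕ → Submodule 𝕜 X) (p : ℕ → ℕ) (a : ℕ → X →L[𝕜] 𝕜) (b : ℕ → X)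
    (C : ℝ) : Prop where
  strictMono : StrictMono p
  zero : p 0 = 0
  mem : ∀ n, ∀ j ∈ Finset.Ico (p n) (p (n + 1)), b j ∈ E n
  apply_eq_zero : ∀ n, ∀ j ∈ Finset.Ico (p n) (p (n + 1)), ∀ m, m ≠ n → ∀ x ∈ E m, a j x = 0
  sum_eq : ∀ n, ∀ x ∈ E n, ∑ j ∈ Finset.Ico (p n) (p (n + 1)), a j x • b j = x
  nonneg : 0 ≤ C
  norm_sum_mul_smul_le : ∀ (l : ℕ → 𝕜), (∀ j, ‖l j‖ ≤ 1) → ∀ (S : Finset ℕ) x,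
    ‖∑ j ∈ S, (l j * a j x) • b j‖ ≤ C * ‖x‖

lemma exists_isBlockFrame_of_finset {E : ℕ → Submodule 𝕜 X} {ι : ℕ → Type*}
    (D : ∀ n, Finset (ι n)) (hD : ∀ n, (D n).Nonempty) (a : ∀ n, ι n → (X →L[𝕜] 𝕜))
    (b : ∀ n, ι n → X) (hb : ∀ n c, b n c ∈ E n)
    (ha : ∀ n c m, m ≠ n → ∀ x ∈ E m, a n c x = 0)
    (hab : ∀ n, ∀ x ∈ E n, ∑ c ∈ D n, a n c x • b n c = x) {C : ℝ} (hC : 0 ≤ C)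
    (h : ∀ (l : ∀ n, ι n → 𝕜), (∀ n c, ‖l n c‖ ≤ 1) → ∀ N x,
      ‖∑ n ∈ Finset.range N, ∑ c ∈ D n, (l n c * a n c x) • b n c‖ ≤ C * ‖x‖) :
    ∃ (p : ℕ → ℕ) (a' : ℕ → X →L[𝕜] 𝕜) (b' : ℕ → X), IsBlockFrame E p a' b' C := by
  classical
  obtain ⟨p, σ, hp, hp0, hσ, himg⟩ := exists_block_enumeration D hD
  have hfst : ∀ n, ∀ j ∈ Finset.Ico (p n) (p (n + 1)), (σ j).1 = n := by
    intro n j hj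
    have h1 := Finset.mem_image_of_mem σ hj
    rw [himg] at h1
    obtain ⟨c, -, hc⟩ := Finset.mem_image.1 h1
    rw [← hc]
  have hsum : ∀ n (f : (Σ n, ι n) → X),
      ∑ j ∈ Finset.Ico (p n) (p (n + 1)), f (σ j) = ∑ c ∈ D n, f ⟨n, c⟩ := by
    intro n f
    rw [← Finset.sum_image (f := f) hσ.injOn, himg, Finset.sum_image sigma_mk_injective.injOn]
  refine ⟨p, fun j => a (σ j).1 (σ j).2, fun j => b (σ j).1 (σ j).2, hp, hp0, fun n j hj => ?_,
    fun n j hj m hm x hx => ?_, fun n x hx => ?_, hC, fun l hl S x => ?_⟩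
  · have := hb (σ j).1 (σ j).2
    exact hfst n j hj ▸ this
  · exact ha _ _ m (by rwa [hfst n j hj]) x hx
  · exact (hsum n fun s => a s.1 s.2 x • b s.1 s.2).trans (hab n x hx)
  · obtain ⟨N, hN⟩ : ∃ N, S ⊆ Finset.range (p N) := ⟨S.sup id + 1, fun j hj =>
      Finset.mem_range.2 ((Nat.lt_succ_of_le (Finset.le_sup (f := id) hj)).trans_le
        (hp.id_le _))⟩
    have : Nonempty ℕ := ⟨0⟩
    let l' : ℕ → 𝕜 := fun j => if j ∈ S then l j else 0
    have hl' : ∀ j, ‖l' j‖ ≤ 1 := fun j => by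
      simp only [l']
      split_ifs
      · exact hl j
      · simp
    have h1 := h (fun n c => l' (Function.invFun σ ⟨n, c⟩)) (fun n c => hl' _) N x
    refine le_trans (le_of_eq ?_) h1
    congr 1
    have h2 : ∑ j ∈ S, (l j * a (σ j).1 (σ j).2 x) • b (σ j).1 (σ j).2 =
        ∑ j ∈ Finset.range (p N), (l' j * a (σ j).1 (σ j).2 x) • b (σ j).1 (σ j).2 := by
      rw [← Finset.sum_subset hN]
      · exact Finset.sum_congr rfl fun j hj => by simp [l', hj]
      · intro j _ hj
        simp [l', hj]
    rw [h2, sum_range_comp_eq_sum_blocks hp.monotone hp0]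
    refine Finset.sum_congr rfl fun n _ => ?_
    rw [← hsum n fun s => (l' (Function.invFun σ s) * a s.1 s.2 x) • b s.1 s.2]
    refine Finset.sum_congr rfl fun j _ => ?_
    rw [Function.leftInverse_invFun hσ j]

/-- A small perturbation of the identity of each `E n` is implemented by an isomorphism `R` of `X`
that maps every `E n` onto itself. -/
lemma IsProjectionSystem.exists_blockDiagonal_inverse [CompleteSpace X]
    {E : ℕ → Submodule 𝕜 X} {Q : ∀ n, X →L[𝕜] E n} {K : ℝ} (hQ : IsProjectionSystem E Q K)
    (hE : ∀ n, FiniteDimensional 𝕜 (E n)) (R : ∀ n, E n →L[𝕜] E n)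
    (hR : ∀ n x, ‖R n x - x‖ ≤ (1 / 4) * (1 / 2) ^ n / (K + 1) * ‖x‖) :
    ∃ S : X →L[𝕜] X, ∀ n, ∀ x ∈ E n, S x ∈ E n ∧ R n (Q n (S x)) = x := by
  have hK := hQ.nonneg
  -- The corrections `(R n - id) ∘ Q n` have norms summing to at most `1/2`, so `1 + ∑ T n` is
  -- invertible; on `E n` it acts as `R n`.
  let T : ℕ → X →L[𝕜] X := fun n =>
    (E n).subtypeL.comp ((R n - ContinuousLinearMap.id 𝕜 (E n)).comp (Q n))
  have hT : ∀ n x, T n x = R n (Q n x) - Q n x := fun n x => by simp [T]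
  have hTn : ∀ n, ‖T n‖ ≤ (1 / 4) * (1 / 2) ^ n := fun n => by
    refine ContinuousLinearMap.opNorm_le_bound _ (by positivity) fun x => ?_
    rw [hT, ← AddSubgroupClass.coe_sub, Submodule.norm_coe]
    calc _ ≤ (1 / 4) * (1 / 2) ^ n / (K + 1) * (K * ‖x‖) := by
          refine (hR _ _).trans ?_
          gcongr
          exact hQ.norm_proj_le n x
      _ = (1 / 4) * (1 / 2) ^ n * ‖x‖ * (K / (K + 1)) := by ring
      _ ≤ (1 / 4) * (1 / 2) ^ n * ‖x‖ * 1 := by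
          gcongr
          exact div_le_one_of_le₀ (by linarith) (by linarith)
      _ = _ := mul_one _
  have hgeom : HasSum (fun n : ℕ => (1 / 4 : ℝ) * (1 / 2) ^ n) (1 / 4 * 2) :=
    hasSum_geometric_two.mul_left _
  have hsum : Summable T := .of_norm_bounded hgeom.summable hTn
  set Δ := ∑' n, T n with hΔ
  have hΔn : ‖-Δ‖ < 1 := by
    rw [norm_neg]
    refine (tsum_of_norm_bounded hgeom hTn).trans_lt (by norm_num)
  let V := Units.oneSub (-Δ) hΔn
  have hV : ∀ n (x : X) (hx : x ∈ E n), (V : X →L[𝕜] X) x = R n ⟨x, hx⟩ := by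
    intro n x hx
    have h1 : Δ x = T n x := by
      have h0 : HasSum (fun k => T k x) (Δ x) :=
        hsum.hasSum.mapL (ContinuousLinearMap.apply 𝕜 X x)
      refine h0.unique (hasSum_single n fun k hk => ?_)
      rw [hT, hQ.apply_of_ne k n hk.symm x hx]
      simp
    have h2 : Q n x = ⟨x, hx⟩ := hQ.apply_self n ⟨x, hx⟩
    have h3 : (V : X →L[𝕜] X) = 1 - -Δ := Units.val_oneSub _ _
    have h4 : (V : X →L[𝕜] X) x = x + Δ x := by rw [h3, sub_neg_eq_add]; rfl
    rw [h4, h1, hT, h2]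
    simp
  have hinv : ∀ x, (↑V⁻¹ : X →L[𝕜] X) ((V : X →L[𝕜] X) x) = x := fun x =>
    congrArg (fun A : X →L[𝕜] X => A x) V.inv_mul
  refine ⟨(↑V⁻¹ : X →L[𝕜] X), fun n x hx => ?_⟩
  -- Injectivity passes from `V` to `R n`, and finite dimension gives surjectivity; hence the
  -- inverse of `V` preserves `E n`.
  have hinj : Function.Injective (R n : E n →ₗ[𝕜] E n) := by
    intro y z hyz
    have h1 : (V : X →L[𝕜] X) y = (V : X →L[𝕜] X) z := by
      rw [hV n y y.2, hV n z z.2]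
      exact congrArg Subtype.val hyz
    have := congrArg (↑V⁻¹ : X →L[𝕜] X) h1
    rw [hinv, hinv] at this
    exact Subtype.ext this
  obtain ⟨y, hy⟩ := LinearMap.injective_iff_surjective.1 hinj ⟨x, hx⟩
  have hy' : R n y = ⟨x, hx⟩ := hy
  have h1 : (V : X →L[𝕜] X) y = x := by
    rw [hV n y y.2]
    exact congrArg Subtype.val hy'
  have h2 : (↑V⁻¹ : X →L[𝕜] X) x = y := by rw [← h1, hinv]
  rw [h2, hQ.apply_self, hy']
  exact ⟨y.2, rfl⟩

/-- Precomposing the functionals with the inverse `S` of the perturbed identity makes the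
approximate frame exact: on `E n` the sum becomes `R n (Q n (S x)) = x`, while the vectors are
unchanged. -/
theorem IsUFDD.exists_isBlockFrame [CompleteSpace X] {E : ℕ → Submodule 𝕜 X} (hE : IsUFDD E)
    (hX : HasLUST 𝕜 X) : ∃ (p : ℕ → ℕ) (a : ℕ → X →L[𝕜] 𝕜) (b : ℕ → X) (C : ℝ),
      IsBlockFrame E p a b C := by
  obtain ⟨Q, K, hQ⟩ := hE.exists_isProjectionSystem
  have hK := hQ.nonneg
  obtain ⟨C, D, b, hC, hDne, happrox, hbd⟩ := hQ.exists_approximate_frame hE.finiteDimensional hX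
    (δ := fun n => (1 / 4) * (1 / 2) ^ n / (K + 1)) (fun n => by positivity) (fun N => by
      have h1 : ∑ n ∈ Finset.range N, (1 / 2 : ℝ) ^ n ≤ 2 := sum_geometric_two_le N
      rw [← Finset.sum_div, ← Finset.mul_sum, div_le_one (by linarith)]
      linarith)
  let R : ∀ n, E n →L[𝕜] E n := fun n => ∑ c ∈ D n, c.smulRight (b n c)
  have hR : ∀ n x, R n x = ∑ c ∈ D n, c x • b n c := fun n x => by simp [R]
  obtain ⟨S, hS⟩ := hQ.exists_blockDiagonal_inverse hE.finiteDimensional R fun n x => by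
    rw [hR]; exact happrox n x
  obtain ⟨p, a', b', h⟩ := exists_isBlockFrame_of_finset (E := E) D hDne
    (fun n c => c.comp ((Q n).comp S)) (fun n c => (b n c : X)) (fun n c => (b n c).2)
    (fun n c m hm x hx => by simp [hQ.apply_of_ne n m hm _ (hS m x hx).1])
    (fun n x hx => by
      have h2 := (hS n x hx).2
      rw [hR] at h2
      push_cast at h2
      exact h2)
    (mul_nonneg hC (norm_nonneg S)) (fun l hl N x => by
      refine (hbd l hl N (S x)).trans ?_
      rw [mul_assoc]
      gcongr
      exact S.le_opNorm x)
  exact ⟨p, a', b', _, h⟩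

end BlockFrame

/-! ### Unconditional convergence from uniform bounds. -/

section UnconditionalBasis

variable {𝕜 : Type v} [RCLike 𝕜]

/-- A series of operators with uniformly bounded partial sums that converges unconditionally on a
dense set converges unconditionally everywhere. -/
lemma exists_continuousLinearMap_hasSum {X V : Type*} [NormedAddCommGroup X] [NormedSpace 𝕜 X]
    [NormedAddCommGroup V] [NormedSpace 𝕜 V] [CompleteSpace V] (T : ℕ → X →L[𝕜] V) {M : ℝ}
    (hM : ∀ (S : Finset ℕ) x, ‖∑ j ∈ S, T j x‖ ≤ M * ‖x‖) {D : Set X} (hD : Dense D)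
    (hT : ∀ x ∈ D, Summable fun j => T j x) :
    ∃ L : X →L[𝕜] V, ∀ x, HasSum (fun j => T j x) (L x) := by
  have hsum : ∀ x, Summable fun j => T j x := by
    intro x
    refine summable_iff_vanishing_norm.2 fun ε hε => ?_
    obtain ⟨d, hdD, hd⟩ := Metric.mem_closure_iff.1 (hD x) (ε / (2 * (|M| + 1))) (by positivity)
    obtain ⟨A, hA⟩ := summable_iff_vanishing_norm.1 (hT d hdD) (ε / 2) (by positivity)
    refine ⟨A, fun S hS => ?_⟩
    have h1 : ∑ j ∈ S, T j x = ∑ j ∈ S, T j (x - d) + ∑ j ∈ S, T j d := by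
      rw [← Finset.sum_add_distrib]
      simp
    have h2 : ‖∑ j ∈ S, T j (x - d)‖ ≤ ε / 2 := by
      rw [dist_eq_norm] at hd
      calc _ ≤ M * ‖x - d‖ := hM _ _
        _ ≤ (|M| + 1) * (ε / (2 * (|M| + 1))) := by
          gcongr
          exact (le_abs_self M).trans (by linarith)
        _ = ε / 2 := by
          have : |M| + 1 ≠ 0 := by positivity
          field_simp
    rw [h1]
    exact (norm_add_le _ _).trans_lt (by linarith [hA S hS])
  let L : X →ₗ[𝕜] V :=
    { toFun := fun x => ∑' j, T j x
      map_add' := fun x y => by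
        simp only [map_add]
        exact (hsum x).tsum_add (hsum y)
      map_smul' := fun c x => by
        simp only [map_smul, RingHom.id_apply]
        exact (hsum x).tsum_const_smul c }
  exact ⟨L.mkContinuous M fun x => le_of_tendsto (hsum x).hasSum.norm
    (Eventually.of_forall fun S => hM S x), fun x => (hsum x).hasSum⟩

/-- A biorthogonal system whose partial sum operators are uniformly bounded is an unconditional
basis of its closed linear span. -/
lemma exists_unconditionalSchauderBasis {W : Type*} [NormedAddCommGroup W] [NormedSpace 𝕜 W]
    [CompleteSpace W] (v : ℕ → W) (φ : ℕ → W →L[𝕜] 𝕜)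
    (hφ : ∀ i j, φ i (v j) = (Pi.single j (1 : 𝕜) : ℕ → 𝕜) i) {M : ℝ}
    (hM : ∀ (S : Finset ℕ), ∀ y ∈ Submodule.span 𝕜 (Set.range v),
      ‖∑ j ∈ S, φ j y • v j‖ ≤ M * ‖y‖) :
    ∃ e : UnconditionalSchauderBasis ℕ 𝕜 (Submodule.span 𝕜 (Set.range v)).topologicalClosure,
      ∀ j, (e.basis j : W) = v j := by
  set Y := (Submodule.span 𝕜 (Set.range v)).topologicalClosure with hY
  have hYc : IsClosed (Y : Set W) := Submodule.isClosed_topologicalClosure _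
  have : CompleteSpace Y := hYc.completeSpace_coe
  have hle : Submodule.span 𝕜 (Set.range v) ≤ Y := Submodule.le_topologicalClosure _
  let v' : ℕ → Y := fun j => ⟨v j, hle (Submodule.subset_span ⟨j, rfl⟩)⟩
  let φ' : ℕ → Y →L[𝕜] 𝕜 := fun j => (φ j).comp Y.subtypeL
  have hφ' : ∀ i j, φ' i (v' j) = (Pi.single j (1 : 𝕜) : ℕ → 𝕜) i := hφ
  have hbd : ∀ (S : Finset ℕ) (y : Y), ‖∑ j ∈ S, ((φ' j).smulRight (v' j)) y‖ ≤ M * ‖y‖ := by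
    intro S y
    have hcl : IsClosed {y : W | ‖∑ j ∈ S, φ j y • v j‖ ≤ M * ‖y‖} :=
      isClosed_le (by fun_prop) (by fun_prop)
    have h1 : (y : W) ∈ {y : W | ‖∑ j ∈ S, φ j y • v j‖ ≤ M * ‖y‖} :=
      hcl.closure_subset_iff.2 (fun z hz => hM S z hz) y.2
    refine le_trans (le_of_eq ?_) h1
    rw [← Submodule.norm_coe]
    simp [φ', v']
  have hdense : Dense (Submodule.span 𝕜 (Set.range v') : Set Y) := by
    intro y
    rw [Topology.IsInducing.subtypeVal.closure_eq_preimage_closure_image, Set.mem_preimage]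
    refine closure_mono ?_ y.2
    have : Submodule.span 𝕜 (Set.range v) =
        (Submodule.span 𝕜 (Set.range v')).map Y.subtype := by
      rw [Submodule.map_span, ← Set.range_comp]
      rfl
    intro z hz
    rw [this] at hz
    obtain ⟨z', hz', rfl⟩ := hz
    exact ⟨z', hz', rfl⟩
  have hspan : ∀ y ∈ Submodule.span 𝕜 (Set.range v'),
      HasSum (fun j => ((φ' j).smulRight (v' j)) y) y := by
    intro y hy
    induction hy using Submodule.span_induction with
    | mem y hy =>
      obtain ⟨k, rfl⟩ := hy
      have : (fun j => ((φ' j).smulRight (v' j)) (v' k)) = Pi.single k (v' k) := by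
        ext j : 1
        rw [ContinuousLinearMap.smulRight_apply, hφ']
        rcases eq_or_ne j k with rfl | h
        · simp
        · simp [Pi.single_eq_of_ne h]
      rw [this]
      exact hasSum_pi_single k (v' k)
    | zero => simp
    | add x y _ _ hx hy => simpa only [map_add] using! hx.add hy
    | smul c x _ hx => simpa only [map_smul] using! hx.const_smul c
  obtain ⟨L, hL⟩ := exists_continuousLinearMap_hasSum (fun j => (φ' j).smulRight (v' j)) hbd
    hdense fun y hy => (hspan y hy).summable
  have hLid : L = ContinuousLinearMap.id 𝕜 Y :=
    ContinuousLinearMap.ext_on hdense fun y hy =>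
      (hL y).unique (hspan y (Submodule.subset_span hy))
  have hexp : ∀ y, HasSum (fun j => φ' j y • v' j) y := fun y => by
    have := hL y
    rwa [hLid] at this
  exact ⟨{ basis := v', coord := φ', ortho := fun i j => by convert hφ' i j, expansion := hexp },
    fun j => rfl⟩

end UnconditionalBasis

/-! ### The sequence space defined by multipliers. -/

section Embedding

variable {𝕜 : Type v} [RCLike 𝕜] {X : Type u} [NormedAddCommGroup X] [NormedSpace 𝕜 X]

lemma IsSchauderDecomposition.dense_span {E : ℕ → Submodule 𝕜 X}
    (hE : IsSchauderDecomposition E) :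
    Dense (Submodule.span 𝕜 (⋃ n, (E n : Set X)) : Set X) := by
  intro x
  obtain ⟨y, ⟨hy, hyx⟩, -⟩ := hE x
  exact mem_closure_of_tendsto hyx (Eventually.of_forall fun N => Submodule.sum_mem _ fun n _ =>
    Submodule.subset_span (Set.mem_iUnion.2 ⟨n, hy n⟩))

lemma IsBlockFrame.apply_eq_zero_of_notMem {E : ℕ → Submodule 𝕜 X} {p : ℕ → ℕ}
    {a : ℕ → X →L[𝕜] 𝕜} {b : ℕ → X} {C : ℝ} (h : IsBlockFrame E p a b C) {n j : ℕ}
    (hj : j ∉ Finset.Ico (p n) (p (n + 1))) {x : X} (hx : x ∈ E n) : a j x = 0 := by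
  obtain ⟨m, hm⟩ := exists_mem_Ico_of_strictMono h.strictMono h.zero j
  exact h.apply_eq_zero m j hm n (fun hnm => hj (hnm ▸ hm)) x hx

variable (𝕜) in
/-- The scalar sequences bounded by one. -/
abbrev Multiplier : Type v := {l : ℕ → 𝕜 // ∀ j, ‖l j‖ ≤ 1}

variable (𝕜 X) in
/-- The Banach space of bounded functions of a multiplier sequence, with values in `X × 𝕜`. -/
abbrev MultiplierSpace : Type (max u v) := lp (fun _ : Multiplier 𝕜 => X × 𝕜) ⊤

/-- The function `l ↦ l j • y` of a multiplier sequence `l`. The norm of `∑ j, c j • (y j)` is thus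
the supremum of `‖∑ j, l j • c j • y j‖` over all multipliers. -/
noncomputable def coordinateVector (j : ℕ) (y : X × 𝕜) : MultiplierSpace 𝕜 X :=
  ⟨fun l => l.1 j • y, memℓp_infty ⟨‖y‖, by
    rintro _ ⟨l, rfl⟩
    change ‖l.1 j • y‖ ≤ ‖y‖
    rw [norm_smul]
    exact mul_le_of_le_one_left (norm_nonneg _) (l.2 j)⟩⟩

@[simp]
lemma coordinateVector_apply (j : ℕ) (y : X × 𝕜) (l : Multiplier 𝕜) :
    coordinateVector j y l = l.1 j • y := rfl

lemma sum_smul_coordinateVector_apply (y : ℕ → X × 𝕜) (c : ℕ → 𝕜) (S : Finset ℕ)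
    (l : Multiplier 𝕜) :
    (∑ j ∈ S, c j • coordinateVector j (y j) : MultiplierSpace 𝕜 X) l =
      ∑ j ∈ S, (l.1 j * c j) • y j := by
  rw [lp.coeFn_sum, Finset.sum_apply]
  refine Finset.sum_congr rfl fun j _ => ?_
  rw [lp.coeFn_smul, Pi.smul_apply, coordinateVector_apply, smul_smul, mul_comm]

/-- Coordinate vectors are 1-unconditional. -/
lemma norm_sum_coordinateVector_le {y : ℕ → X × 𝕜} {ψ : ℕ → MultiplierSpace 𝕜 X →L[𝕜] 𝕜}
    (hψ : ∀ i j, ψ i (coordinateVector j (y j)) = (Pi.single j (1 : 𝕜) : ℕ → 𝕜) i)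
    (S : Finset ℕ) {f : MultiplierSpace 𝕜 X}
    (hf : f ∈ Submodule.span 𝕜 (Set.range fun j => coordinateVector j (y j))) :
    ‖∑ j ∈ S, ψ j f • coordinateVector j (y j)‖ ≤ ‖f‖ := by
  classical
  refine lp.norm_le_of_forall_le (norm_nonneg _) fun l => ?_
  -- Projecting `f` to the coordinates in `S` and evaluating at `l` equals evaluating `f` at `l` cut
  -- off outside `S`.
  let l' : Multiplier 𝕜 := ⟨fun j => if j ∈ S then l.1 j else 0, fun j => by
    dsimp only
    split_ifs
    · exact l.2 j
    · simp⟩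
  suffices h : ∑ j ∈ S, (l.1 j * ψ j f) • y j = f l' by
    rw [sum_smul_coordinateVector_apply, h]
    exact lp.norm_apply_le_norm (by simp) f l'
  induction hf using Submodule.span_induction with
  | mem f hf =>
    obtain ⟨k, rfl⟩ := hf
    simp only [hψ, coordinateVector_apply, l']
    split_ifs with hk
    · rw [Finset.sum_eq_single k]
      · simp
      · intro j _ hj
        simp [Pi.single_eq_of_ne hj]
      · exact fun h => absurd hk h
    · rw [zero_smul]
      refine Finset.sum_eq_zero fun j hj => ?_
      have : j ≠ k := fun h => hk (h ▸ hj)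
      simp [Pi.single_eq_of_ne this]
  | zero => simp
  | add f g _ _ hf hg =>
    rw [lp.coeFn_add, Pi.add_apply, ← hf, ← hg, ← Finset.sum_add_distrib]
    simp only [map_add, mul_add, add_smul]
  | smul c f _ hf =>
    rw [lp.coeFn_smul, Pi.smul_apply, ← hf, Finset.smul_sum]
    refine Finset.sum_congr rfl fun j _ => ?_
    rw [map_smul, smul_eq_mul, smul_smul, mul_left_comm]

/-- The embedding of a space with a block frame into a space with an unconditional basis, the
coefficients of the frame becoming the coordinates of a vector. -/
lemma IsBlockFrame.exists_embedding [CompleteSpace X] {E : ℕ → Submodule 𝕜 X}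
    (hE : IsSchauderDecomposition E) {p : ℕ → ℕ} {a : ℕ → X →L[𝕜] 𝕜} {b : ℕ → X} {C : ℝ}
    (h : IsBlockFrame E p a b C) :
    ∃ (u : ℕ → MultiplierSpace 𝕜 X) (ψ : ℕ → MultiplierSpace 𝕜 X →L[𝕜] 𝕜)
      (β : MultiplierSpace 𝕜 X →L[𝕜] X) (J : X →L[𝕜] MultiplierSpace 𝕜 X),
      (∀ i j, ψ i (u j) = (Pi.single j (1 : 𝕜) : ℕ → 𝕜) i) ∧ (∀ j, β (u j) = b j) ∧
      (∀ S, ∀ f ∈ Submodule.span 𝕜 (Set.range u), ‖∑ j ∈ S, ψ j f • u j‖ ≤ ‖f‖) ∧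
      (∀ x, β (J x) = x) ∧ ∀ x, HasSum (fun j => a j x • u j) (J x) := by
  classical
  -- The scalar component `t j` keeps `u j` nonzero even if `b j = 0` and makes coefficients
  -- readable by bounded functionals. Its decay gives `∑ ‖a j x‖ * t j ≤ 2 * ‖x‖`, so boundedness of
  -- the embedding survives.
  set t : ℕ → ℝ := fun j => (1 / 2) ^ j / (‖a j‖ + 1) with ht
  have ht0 : ∀ j, 0 < t j := fun j => by positivity
  have hta : ∀ (S : Finset ℕ) x, ∑ j ∈ S, ‖a j x‖ * t j ≤ 2 * ‖x‖ := by
    intro S x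
    calc ∑ j ∈ S, ‖a j x‖ * t j ≤ ∑ j ∈ S, (1 / 2) ^ j * ‖x‖ := by
          refine Finset.sum_le_sum fun j _ => ?_
          calc ‖a j x‖ * t j ≤ ((‖a j‖ + 1) * ‖x‖) * t j := by
                have := (ht0 j).le
                gcongr
                refine ((a j).le_opNorm x).trans ?_
                gcongr
                linarith
            _ = _ := by
                have : ‖a j‖ + 1 ≠ 0 := by positivity
                simp only [ht]
                field_simp
      _ ≤ _ := by
          rw [← Finset.sum_mul]
          gcongr
          exact sum_le_hasSum S (fun j _ => by positivity) hasSum_geometric_two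
  set y : ℕ → X × 𝕜 := fun j => (b j, (t j : 𝕜)) with hy
  let u : ℕ → MultiplierSpace 𝕜 X := fun j => coordinateVector j (y j)
  let ev : Multiplier 𝕜 → MultiplierSpace 𝕜 X →L[𝕜] X × 𝕜 := fun l =>
    lp.evalCLM 𝕜 (fun _ : Multiplier 𝕜 => X × 𝕜) ⊤ l
  -- Evaluation at the constant multiplier recovers `∑ c j • b j`; evaluation at `single i` isolates
  -- `c i * t i`.
  let one : Multiplier 𝕜 := ⟨fun _ => 1, fun _ => by simp⟩
  let single : ℕ → Multiplier 𝕜 := fun i => ⟨Pi.single i 1, fun j => by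
    rw [Pi.single_apply]
    split_ifs <;> simp⟩
  let β : MultiplierSpace 𝕜 X →L[𝕜] X := (ContinuousLinearMap.fst 𝕜 X 𝕜).comp (ev one)
  let ψ : ℕ → MultiplierSpace 𝕜 X →L[𝕜] 𝕜 := fun i =>
    (t i : 𝕜)⁻¹ • (ContinuousLinearMap.snd 𝕜 X 𝕜).comp (ev (single i))
  have hψ : ∀ i j, ψ i (u j) = (Pi.single j (1 : 𝕜) : ℕ → 𝕜) i := by
    intro i j
    have h1 : ψ i (u j) = (t i : 𝕜)⁻¹ * ((Pi.single i (1 : 𝕜) : ℕ → 𝕜) j * (t j : 𝕜)) := rfl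
    rw [h1]
    rcases eq_or_ne i j with rfl | hij
    · have : (t i : 𝕜) ≠ 0 := by exact_mod_cast (ht0 i).ne'
      simp [this]
    · simp [Pi.single_eq_of_ne hij, Pi.single_eq_of_ne hij.symm]
  have hβ : ∀ j, β (u j) = b j := fun j => one_smul 𝕜 (b j)
  have hbd : ∀ (S : Finset ℕ) x, ‖∑ j ∈ S, ((a j).smulRight (u j)) x‖ ≤ (C + 2) * ‖x‖ := by
    intro S x
    have hC := h.nonneg
    refine lp.norm_le_of_forall_le (by positivity) fun l => ?_
    have h1 : (∑ j ∈ S, ((a j).smulRight (u j)) x : MultiplierSpace 𝕜 X) l =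
        ∑ j ∈ S, (l.1 j * a j x) • y j :=
      sum_smul_coordinateVector_apply y (fun j => a j x) S l
    rw [h1, Prod.norm_def, Prod.fst_sum, Prod.snd_sum]
    refine max_le ?_ ?_
    · refine (h.norm_sum_mul_smul_le l.1 l.2 S x).trans ?_
      gcongr
      linarith
    · refine (norm_sum_le _ _).trans ?_
      calc _ ≤ ∑ j ∈ S, ‖a j x‖ * t j := by
            refine Finset.sum_le_sum fun j _ => ?_
            have h2 : ‖l.1 j‖ * ‖a j x‖ ≤ ‖a j x‖ :=
              mul_le_of_le_one_left (norm_nonneg _) (l.2 j)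
            have h3 : ‖((l.1 j * a j x) • y j).2‖ = ‖l.1 j‖ * ‖a j x‖ * t j := by
              simp [hy, abs_of_pos (ht0 j)]
            rw [h3]
            have := (ht0 j).le
            gcongr
        _ ≤ 2 * ‖x‖ := hta S x
        _ ≤ _ := by
            gcongr
            linarith
  have hsumE : ∀ n, ∀ x ∈ E n, HasSum (fun j => ((a j).smulRight (u j)) x)
      (∑ j ∈ Finset.Ico (p n) (p (n + 1)), a j x • u j) := fun n x hx =>
    hasSum_sum_of_ne_finset_zero fun j hj => by
      rw [ContinuousLinearMap.smulRight_apply, h.apply_eq_zero_of_notMem hj hx, zero_smul]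
  obtain ⟨J, hJ⟩ := exists_continuousLinearMap_hasSum (fun j => (a j).smulRight (u j)) hbd
    hE.dense_span fun x hx => by
      induction hx using Submodule.span_induction with
      | mem x hx =>
        obtain ⟨n, hn⟩ := Set.mem_iUnion.1 hx
        exact (hsumE n x hn).summable
      | zero => simp
      | add x y _ _ hx hy => simpa only [map_add] using! hx.add hy
      | smul c x _ hx => simpa only [map_smul] using! hx.const_smul c
  refine ⟨u, ψ, β, J, hψ, hβ, fun S f hf => norm_sum_coordinateVector_le hψ S hf, fun x => ?_, hJ⟩
  have : β.comp J = ContinuousLinearMap.id 𝕜 X := by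
    refine ContinuousLinearMap.ext_on hE.dense_span fun x hx => ?_
    obtain ⟨n, hn⟩ := Set.mem_iUnion.1 hx
    rw [ContinuousLinearMap.comp_apply, (hJ x).unique (hsumE n x hn), map_sum]
    simp only [map_smul, hβ]
    exact h.sum_eq n x hn
  exact congrArg (fun A : X →L[𝕜] X => A x) this

end Embedding

/-! ### Making the embedding isometric. -/

theorem proposition3p3 {𝕜 : Type v} [RCLike 𝕜] {X : Type u} [NormedAddCommGroup X]
    [NormedSpace 𝕜 X] [CompleteSpace X] (E : ℕ → Submodule 𝕜 X) (hE : IsUFDD E)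
    (hX : HasLUST 𝕜 X) :
    ∃ (Y : Type (max u v)) (_ : NormedAddCommGroup Y) (_ : NormedSpace 𝕜 Y) (_ : CompleteSpace Y)
      (e : UnconditionalSchauderBasis ℕ 𝕜 Y) (J : X →ₗᵢ[𝕜] Y),
      IsComplementedBlockUFDD e (fun n => (E n).map J.toLinearMap) := by
  obtain ⟨p, a, b, C, hframe⟩ := hE.exists_isBlockFrame hX
  obtain ⟨u, ψ, β, J₀, hψ, hβu, hu, hβJ, hJ⟩ := hframe.exists_embedding hE.decomposition
  -- Splitting `f` into `β f` and the remainder `f - J₀ (β f)` is an equivalent renorming, with left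
  -- inverse `Ψ`. It sends `J₀ x` to `(x, 0)`, which has norm `‖x‖`.
  let Φ : MultiplierSpace 𝕜 X →L[𝕜] X × MultiplierSpace 𝕜 X :=
    β.prod (ContinuousLinearMap.id 𝕜 _ - J₀.comp β)
  let Ψ : X × MultiplierSpace 𝕜 X →L[𝕜] MultiplierSpace 𝕜 X :=
    ContinuousLinearMap.snd 𝕜 _ _ + J₀.comp (ContinuousLinearMap.fst 𝕜 _ _)
  have hΨΦ : ∀ f, Ψ (Φ f) = f := fun f => by simp [Ψ, Φ]
  have hΦJ : ∀ x, Φ (J₀ x) = (x, 0) := fun x => by simp [Φ, hβJ]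
  set v : ℕ → X × MultiplierSpace 𝕜 X := fun j => Φ (u j) with hv
  have hJv : ∀ x, HasSum (fun j => a j x • v j) (x, 0) := fun x => by
    have := Φ.hasSum (hJ x)
    rw [hΦJ] at this
    simpa only [map_smul] using! this
  let Y := (Submodule.span 𝕜 (Set.range v)).topologicalClosure
  obtain ⟨e, he⟩ : ∃ e : UnconditionalSchauderBasis ℕ 𝕜 Y,
      ∀ j, (e.basis j : X × MultiplierSpace 𝕜 X) = v j :=
    exists_unconditionalSchauderBasis v (fun j => (ψ j).comp Ψ)
    (fun i j => by rw [ContinuousLinearMap.comp_apply, hΨΦ, hψ]) (M := ‖Φ‖ * ‖Ψ‖) (by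
      intro S y hy
      have h1 : Submodule.span 𝕜 (Set.range v) =
          (Submodule.span 𝕜 (Set.range u)).map Φ.toLinearMap := by
        rw [Submodule.map_span, ← Set.range_comp]
        rfl
      rw [h1] at hy
      obtain ⟨f, hf, rfl⟩ := hy
      have h2 : ∑ j ∈ S, ((ψ j).comp Ψ) (Φ f) • v j = Φ (∑ j ∈ S, ψ j f • u j) := by
        simp only [ContinuousLinearMap.comp_apply, hΨΦ, map_sum, map_smul, hv]
      calc ‖∑ j ∈ S, ((ψ j).comp Ψ) (Φ f) • v j‖ ≤ ‖Φ‖ * ‖f‖ := by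
            rw [h2]
            refine (Φ.le_opNorm _).trans ?_
            gcongr
            exact hu S f hf
        _ = ‖Φ‖ * ‖Ψ (Φ f)‖ := by rw [hΨΦ]
        _ ≤ ‖Φ‖ * (‖Ψ‖ * ‖Φ f‖) := by
            gcongr
            exact Ψ.le_opNorm _
        _ = _ := (mul_assoc _ _ _).symm)
  have hYc : IsClosed (Y : Set (X × MultiplierSpace 𝕜 X)) :=
    Submodule.isClosed_topologicalClosure _
  have hmem : ∀ x : X, ((x, 0) : X × MultiplierSpace 𝕜 X) ∈ Y := fun x =>
    hYc.mem_of_tendsto (hJv x) (Eventually.of_forall fun S => Submodule.sum_mem _ fun j _ =>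
      Submodule.smul_mem _ _ (Submodule.le_topologicalClosure _ (Submodule.subset_span ⟨j, rfl⟩)))
  let J : X →ₗᵢ[𝕜] Y :=
    { toLinearMap := (LinearMap.inl 𝕜 X (MultiplierSpace 𝕜 X)).codRestrict Y hmem
      norm_map' := fun x => by
        change ‖((x, 0) : X × MultiplierSpace 𝕜 X)‖ = ‖x‖
        simp [Prod.norm_def] }
  have hJcoe : ∀ x, (J x : X × MultiplierSpace 𝕜 X) = (x, 0) := fun x => rfl
  -- In the split picture the projection keeps the `X` component, so it sends the `j`-th basis
  -- vector to `J (b j)`.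
  let P : Y →L[𝕜] Y :=
    J.toContinuousLinearMap.comp ((ContinuousLinearMap.fst 𝕜 _ _).comp Y.subtypeL)
  have hP : ∀ y, P y = J (y : X × MultiplierSpace 𝕜 X).1 := fun y => rfl
  have hPe : ∀ j, P (e.basis j) = J (b j) := fun j => by
    rw [hP, he]
    exact congrArg J (hβu j)
  have hJE : ∀ n, ∀ x ∈ E n,
      J x = ∑ j ∈ Finset.Ico (p n) (p (n + 1)), a j x • e.basis j := by
    intro n x hx
    apply Subtype.ext
    push_cast
    simp only [he]
    rw [hJcoe]
    refine (hJv x).unique (hasSum_sum_of_ne_finset_zero fun j hj => ?_)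
    rw [hframe.apply_eq_zero_of_notMem hj hx, zero_smul]
  have hJspan : ∀ n, ∀ x ∈ E n,
      J x ∈ Submodule.span 𝕜 (e.basis '' Set.Ico (p n) (p (n + 1))) := fun n x hx => by
    rw [hJE n x hx]
    exact Submodule.sum_mem _ fun j hj => Submodule.smul_mem _ _
      (Submodule.subset_span ⟨j, by simpa using hj, rfl⟩)
  refine ⟨Y, inferInstance, inferInstance, hYc.completeSpace_coe, e, J, p, P, hframe.strictMono,
    hframe.zero, ContinuousLinearMap.ext fun y => rfl, fun n => ⟨?_, le_antisymm ?_ ?_⟩⟩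
  · rintro _ ⟨x, hx, rfl⟩
    exact hJspan n x hx
  · rw [Submodule.map_span_le]
    rintro _ ⟨j, hj, rfl⟩
    exact ⟨b j, hframe.mem n j (by simpa using hj), (hPe j).symm⟩
  · rintro _ ⟨x, hx, rfl⟩
    exact ⟨J x, hJspan n x hx, rfl⟩
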